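/- **Theorem 2.** Consider the real linear time-invariant system $$x_{k+1}=Ax_k+Bu_k,\qquad y_k=Cx_k+Du_k,\qquad x_k\in\mathbb R^n,\ u_k,y_k\in\mathbb R^m,$$ and assume that this realisation is minimal, i.e. no state-space realisation with fewer states has the same input-output map from zero initial state. This map extends to complex-valued inputs by $$(u_0,u_1,\dots)\mapsto(y_0,y_1,\dots),\qquad y_j=\sum_{i=0}^{j-1}CA^{j-1-i}Bu_i+Du_j .$$ Let $\ell_2^m$ be the Hilbert space of square-summable sequences $\{0,1,2,\dots\}\to\mathbb C^m$. For $\tau\in\{1,2,\dots\}$ let $\ell_{2,\tau}^m\subseteq\ell_2^m$ be the subspace of sequences that vanish at all times $k\ge\tau$. Let $\mathbf T^\tau:\ell_{2,\tau}^m\to\ell_{2,\tau}^m$ be the operator $u\mapsto(y_0,\dots,y_{\tau-1},0,0,\dots)$, and let $\mathbf T:\operatorname{dom}(\mathbf T)\subseteq\ell_2^m\to\ell_2^m$ be the operator $u\mapsto y$ with domain $\operatorname{dom}(\mathbf T)=\{u\in\ell_2^m : y\in\ell_2^m\}$. For a linear operator $\mathbf S$ put $$\overline\sigma(\mathbf S)=\sup_{0\ne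 u\in\operatorname{dom}(\mathbf S)}\frac{\|\mathbf Su\|}{\|u\|}\in[0,\infty],\qquad \underline\sigma(\mathbf S)=\inf_{0\ne u\in\operatorname{dom}(\mathbf S)}\frac{\|\mathbf Su\|}{\|u\|}\in[0,\infty].$$ The lag of the system is the smallest $l\in\{1,2,\dots\}$ such that $\begin{pmatrix}C^\top&(CA)^\top&\cdots&(CA^{l-1})^\top\end{pmatrix}^\top$ has rank $n$. Let $l$ be an integer greater than or equal to the lag, and let $(u_k,y_k)_{k=0}^{N-1}$ be an input-output trajectory of the system (with some, not necessarily zero, initial state) whose input is persistently exciting of order $n+l+1$: with $L=n+l+1$, the block Hankel matrix with blocks $u_{i+j}$, $0\le i\le L-1$, $0\le j\le N-L$, has rank $mL$. Put $$\xi_k=\begin{pmatrix}u_{k-l}^\top&\cdots&u_{k-1}^\top&y_{k-l}^\top&\cdots&y_{k-1}^\top\end{pmatrix}^\top\in\mathbb R^{2ml},$$ $$\Xi=(\xi_l\ \cdots\ \xi_{N-1}),\quad \Xi_+=(\xi_{l+1}\ \cdots\ \xi_N),\quad U_\Xi=(u_l\ \cdots\ u_{N-1}),\quad Y_\Xi=(y_l\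 \cdots\ y_{N-1}).$$ For a real symmetric $2ml\times 2ml$ matrix $P$ and real $\gamma,\zeta\ge0$ consider the linear matrix inequalities $$\text{(1)}\quad \Xi_+^\top P\,\Xi_+-\Xi^\top P\,\Xi+Y_\Xi^\top Y_\Xi-\gamma^2U_\Xi^\top U_\Xi\preceq0,$$ $$\text{(2)}\quad \Xi_+^\top P\,\Xi_+-\Xi^\top P\,\Xi-Y_\Xi^\top Y_\Xi+\zeta^2U_\Xi^\top U_\Xi\preceq0 .$$ Then, in $[0,\infty]$ and with $\inf\emptyset=\infty$, the following limits exist and $$\lim_{\tau\to\infty}\overline\sigma(\mathbf T^\tau)=\inf\{\gamma\ge0:\exists\,P=P^\top\succeq0\text{ satisfying (1)}\},$$ $$\lim_{\tau\to\infty}\underline\sigma(\mathbf T^\tau)=\sup\{\zeta\ge0:\exists\,P=P^\top\succeq0\text{ satisfying (2)}\}.$$ Without the constraint $P\succeq0$ the same inequalities give the gains of $\mathbf T$: $$\overline\sigma(\mathbf T)=\inf\{\gamma\ge0:\exists\,P=P^\top\text{ satisfying (1)}\},$$ $$\underline\sigma(\mathbf T)=\sup\{\zeta\ge0:\exists\,P=P^\top\text{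 satisfying (2)}\}.$$ -/

import Mathlib

open Filter Topology
open scoped NNReal ENNReal Matrix

noncomputable section

/-- The Hilbert space `ℓ₂^m` of square-summable sequences `0, 1, 2, … → ℂ^m`. -/
abbrev ELL2 (m : ℕ) : Type := lp (fun _ : ℕ => EuclideanSpace ℂ (Fin m)) 2

/-- The subspace `ℓ_{2,τ}^m` of sequences that vanish at all times `k ≥ τ`. -/
def ell2Trunc (m τ : ℕ) : Submodule ℂ (ELL2 m) where
  carrier := {f | ∀ k, τ ≤ k → f k = 0}
  zero_mem' := fun _ _ => rfl
  add_mem' := by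
    intro f g hf hg k hk
    simp [hf k hk, hg k hk]
  smul_mem' := by
    intro c f hf k hk
    simp [hf k hk]

section Gains

variable {E F : Type*} [NormedAddCommGroup E] [NormedSpace ℂ E]
  [NormedAddCommGroup F] [NormedSpace ℂ F]

/-- Maximum gain `sup ‖T u‖ / ‖u‖` over nonzero `u ∈ dom T`, with values in `[0, ∞]`. -/
def maxGain (T : E →ₗ.[ℂ] F) : ℝ≥0∞ :=
  ⨆ (u : T.domain) (_ : u ≠ 0), ‖T u‖ₑ / ‖(u : E)‖ₑ

/-- Minimum gain `inf ‖T u‖ / ‖u‖` over nonzero `u ∈ dom T`, with values in `[0, ∞]`. -/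
def minGain (T : E →ₗ.[ℂ] F) : ℝ≥0∞ :=
  ⨅ (u : T.domain) (_ : u ≠ 0), ‖T u‖ₑ / ‖(u : E)‖ₑ

end Gains

/-- Real state-space data of the system `x (k+1) = A x k + B u k`, `y k = C x k + D u k` with
`n` states, `m` inputs and `m` outputs. -/
structure StateSpace (n m : ℕ) where
  A : Matrix (Fin n) (Fin n) ℝ
  B : Matrix (Fin n) (Fin m) ℝ
  C : Matrix (Fin m) (Fin n) ℝ
  D : Matrix (Fin m) (Fin m) ℝ

/-- A real `m × m` matrix acting on `ℂ^m`. -/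
def complexAct {m : ℕ} (M : Matrix (Fin m) (Fin m) ℝ) :
    EuclideanSpace ℂ (Fin m) →ₗ[ℂ] EuclideanSpace ℂ (Fin m) :=
  Matrix.toEuclideanLin (M.map (algebraMap ℝ ℂ))

namespace StateSpace

variable {n m : ℕ}

/-- The input-output map for zero initial state, on arbitrary sequences:
`y j = ∑_{i < j} C A^(j-1-i) B u i + D u j`. -/
def response (S : StateSpace n m) :
    (ℕ → EuclideanSpace ℂ (Fin m)) →ₗ[ℂ] (ℕ → EuclideanSpace ℂ (Fin m)) where
  toFun u := fun j =>
    (∑ i ∈ Finset.range j, complexAct (S.C * S.A ^ (j - 1 - i) * S.B) (u i))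
      + complexAct S.D (u j)
  map_add' := by
    intro u v
    funext j
    simp only [Pi.add_apply, map_add, Finset.sum_add_distrib]
    abel
  map_smul' := by
    intro c u
    funext j
    simp only [Pi.smul_apply, map_smul, RingHom.id_apply, smul_add, Finset.smul_sum]

/-- A realisation is minimal if no realisation of the same input-output map has fewer states. -/
def IsMinimal (S : StateSpace n m) : Prop :=
  ∀ (n' : ℕ) (S' : StateSpace n' m), S'.response = S.response → n ≤ n'

/-- The matrix `(Cᵀ, (C A)ᵀ, …, (C A^(l-1))ᵀ)ᵀ`. -/
def obsMatrix (S : StateSpace n m) (l : ℕ) : Matrix (Fin l × Fin m) (Fin n) ℝ :=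
  Matrix.of fun p b => (S.C * S.A ^ (p.1 : ℕ)) p.2 b

/-- The lag: the smallest `l ∈ {1, 2, …}` for which `obsMatrix l` has rank `n`. -/
def lag (S : StateSpace n m) : ℕ :=
  sInf {l : ℕ | 1 ≤ l ∧ (S.obsMatrix l).rank = n}

/-- `(u k, y k)`, `k = 0, …, N-1`, is an input-output trajectory of the system, for some
initial state `x 0`. Values of `u` and `y` at times `k ≥ N` play no role. -/
def IsTrajectory (S : StateSpace n m) (N : ℕ) (u y : ℕ → Fin m → ℝ) : Prop :=
  ∃ x : ℕ → Fin n → ℝ, ∀ k < N,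
    x (k + 1) = S.A *ᵥ x k + S.B *ᵥ u k ∧ y k = S.C *ᵥ x k + S.D *ᵥ u k

/-- Output on `ℓ_{2,τ}^m`: the response, set to zero at times `k ≥ τ`. -/
def truncResponse (S : StateSpace n m) (τ : ℕ) (u : ELL2 m) :
    ℕ → EuclideanSpace ℂ (Fin m) :=
  fun k => if k < τ then S.response u k else 0

theorem memlp_truncResponse (S : StateSpace n m) (τ : ℕ) (u : ELL2 m) :
    Memℓp (S.truncResponse τ u) 2 := by
  have h0 : Memℓp (S.truncResponse τ u) 0 := by
    apply memℓp_zero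
    refine (Set.finite_lt_nat τ).subset ?_
    intro k hk
    by_contra hk'
    exact hk (if_neg hk')
  exact h0.of_exponent_ge (by simp)

/-- The operator `T^τ : ℓ_{2,τ}^m → ℓ_{2,τ}^m` (everywhere defined). -/
def truncOp (S : StateSpace n m) (τ : ℕ) : ell2Trunc m τ →ₗ.[ℂ] ell2Trunc m τ :=
  LinearMap.toPMap
    { toFun := fun u => ⟨⟨S.truncResponse τ u, S.memlp_truncResponse τ u⟩,
        fun _ hk => if_neg (not_lt.mpr hk)⟩
      map_add' := by
        intro u v
        apply Subtype.ext
        apply Subtype.ext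
        funext k
        change S.truncResponse τ (u + v : ELL2 m) k
          = S.truncResponse τ u k + S.truncResponse τ v k
        by_cases hk : k < τ
        · simp only [truncResponse, if_pos hk]
          exact congrFun (S.response.map_add (u : ELL2 m) (v : ELL2 m)) k
        · simp [truncResponse, hk]
      map_smul' := by
        intro c u
        apply Subtype.ext
        apply Subtype.ext
        funext k
        by_cases hk : k < τ <;> simp [truncResponse, hk] } ⊤

/-- The operator `T : dom T ⊆ ℓ₂^m → ℓ₂^m`, with `dom T = {u ∈ ℓ₂^m | y ∈ ℓ₂^m}`. -/
def op (S : StateSpace n m) : ELL2 m →ₗ.[ℂ] ELL2 m where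
  domain :=
    { carrier := {u | Memℓp (S.response u) 2}
      zero_mem' := by
        have h : S.response ((0 : ELL2 m) : ℕ → EuclideanSpace ℂ (Fin m)) = 0 := by
          rw [lp.coeFn_zero, map_zero]
        change Memℓp _ 2
        rw [h]
        exact zero_memℓp
      add_mem' := by
        intro u v hu hv
        change Memℓp _ 2
        rw [lp.coeFn_add, map_add]
        exact Memℓp.add hu hv
      smul_mem' := by
        intro c u hu
        change Memℓp _ 2
        rw [lp.coeFn_smul, map_smul]
        exact Memℓp.const_smul hu c }
  toFun :=
    { toFun := fun u => ⟨S.response (u : ELL2 m), u.2⟩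
      map_add' := by
        intro u v
        apply Subtype.ext
        funext k
        change S.response (u + v : ELL2 m) k = S.response (u : ELL2 m) k + S.response (v : ELL2 m) k
        exact congrFun (S.response.map_add (u : ELL2 m) (v : ELL2 m)) k
      map_smul' := by
        intro c u
        apply Subtype.ext
        funext k
        simp }

end StateSpace

section Data

variable {m : ℕ}

/-- The block Hankel matrix of order `L` of `u 0, …, u (N-1)`, with block `u (i + j)` in block
row `i = 0, …, L-1` and column `j = 0, …, N-L`. -/
def hankel (N : ℕ) (u : ℕ → Fin m → ℝ) (L : ℕ) :
    Matrix (Fin L × Fin m) (Fin (N + 1 - L)) ℝ :=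
  Matrix.of fun p j => u (p.1 + j) p.2

/-- `u 0, …, u (N-1)` is persistently exciting of order `L`. -/
def PersistentlyExciting (N : ℕ) (u : ℕ → Fin m → ℝ) (L : ℕ) : Prop :=
  (hankel N u L).rank = m * L

/-- Index set of the entries of the extended state, of size `2 m l`. -/
abbrev ExtIdx (m l : ℕ) : Type := (Fin l × Fin m) ⊕ (Fin l × Fin m)

/-- The extended state `ξ k = (u (k-l), …, u (k-1), y (k-l), …, y (k-1))`, for `k ≥ l`. -/
def extState (l : ℕ) (u y : ℕ → Fin m → ℝ) (k : ℕ) : ExtIdx m l → ℝ :=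
  Sum.elim (fun p => u (k - l + p.1) p.2) (fun p => y (k - l + p.1) p.2)

/-- `Ξ = (ξ l, …, ξ (N-1))`. -/
def dataXi (N l : ℕ) (u y : ℕ → Fin m → ℝ) : Matrix (ExtIdx m l) (Fin (N - l)) ℝ :=
  Matrix.of fun p j => extState l u y (l + j) p

/-- `Ξ₊ = (ξ (l+1), …, ξ N)`. -/
def dataXiPlus (N l : ℕ) (u y : ℕ → Fin m → ℝ) : Matrix (ExtIdx m l) (Fin (N - l)) ℝ :=
  Matrix.of fun p j => extState l u y (l + 1 + j) p

/-- `(w l, …, w (N-1))`; this is `U_Ξ` for `w = u` and `Y_Ξ` for `w = y`. -/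
def dataSignal (N l : ℕ) (w : ℕ → Fin m → ℝ) : Matrix (Fin m) (Fin (N - l)) ℝ :=
  Matrix.of fun a j => w (l + j) a

/-- `Ξ₊ᵀ P Ξ₊ - Ξᵀ P Ξ + Y_Ξᵀ Y_Ξ - γ² U_Ξᵀ U_Ξ ⪯ 0`. -/
def MaxGainLMI (N l : ℕ) (u y : ℕ → Fin m → ℝ) (P : Matrix (ExtIdx m l) (ExtIdx m l) ℝ)
    (γ : ℝ) : Prop :=
  (-((dataXiPlus N l u y)ᵀ * P * dataXiPlus N l u y - (dataXi N l u y)ᵀ * P * dataXi N l u y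
    + (dataSignal N l y)ᵀ * dataSignal N l y
    - γ ^ 2 • ((dataSignal N l u)ᵀ * dataSignal N l u))).PosSemidef

/-- `Ξ₊ᵀ P Ξ₊ - Ξᵀ P Ξ - Y_Ξᵀ Y_Ξ + ζ² U_Ξᵀ U_Ξ ⪯ 0`. -/
def MinGainLMI (N l : ℕ) (u y : ℕ → Fin m → ℝ) (P : Matrix (ExtIdx m l) (ExtIdx m l) ℝ)
    (ζ : ℝ) : Prop :=
  (-((dataXiPlus N l u y)ᵀ * P * dataXiPlus N l u y - (dataXi N l u y)ᵀ * P * dataXi N l u y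
    - (dataSignal N l y)ᵀ * dataSignal N l y
    + ζ ^ 2 • ((dataSignal N l u)ᵀ * dataSignal N l u))).PosSemidef

end Data

end

/-! All four identities are dissipativity statements for a supply rate `a |y|² + b |u|²`, with `(a,
b) = (1, -γ²)` for maximum gains and `(-1, ζ²)` for minimum gains. Splitting complex signals into
real and imaginary parts turns a bound on a gain into a sign condition on total supplies along real
trajectories from the zero state: for `T^τ` over all trajectories of length `τ`; for `T`, in
particular, over those that return to zero, whose inputs and outputs are finitely supported.

From LMI to gain: by minimality and persistency of excitation the data windows span all windows of
length `l + 1` (the fundamental lemma, `exists_window_combination`), so the LMI makes `ξᵀ P ξ` a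
storage function along every trajectory (`DataDissipative.extAt_le`). Summed from rest, the
inequality bounds the total supply by minus the final storage. This is nonpositive if `P ⪰ 0`, and
tends to zero for any `P` when input and output are square-summable.

From gain to LMI: the supremum of the supply over trajectories from `x` that come to rest is finite,
because such a trajectory can be closed up to a cycle through zero. A supremum of a quadratic form
over the fibres of a linear relation is again quadratic (`exists_quadraticForm_eq_sSup`), so
`exists_isStorage` yields a storage function `xᵀ Q x`. Observability writes the state as `x = M ξ`,
and `P = Mᵀ Q M` solves the LMI.

For the truncated operators `Q` must also be nonnegative. From each state there is an input whose
supply dominates `c (|u|² + |y|²)` with `c > 0`: the zero input for the maximum gain, an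
output-zeroing input for the minimum gain. Bounded supply forces decay of the trajectory, hence `Q ⪰
0` (`IsStorage.nonneg_of_supply`). -/

/-! ### Ranks, kernels and powers of matrices. -/

theorem Matrix.mulVec_eq_zero_of_rank {ι κ : Type*} [Fintype ι] [Fintype κ] {M : Matrix ι κ ℝ}
    (h : M.rank = Fintype.card κ) {v : κ → ℝ} (hv : M *ᵥ v = 0) : v = 0 := by
  have h1 := LinearMap.finrank_range_add_finrank_ker M.mulVecLin
  rw [show Module.finrank ℝ (LinearMap.range M.mulVecLin) = M.rank from rfl, h,
    Module.finrank_fintype_fun_eq_card] at h1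
  have h2 : LinearMap.ker M.mulVecLin = ⊥ := Submodule.finrank_eq_zero.mp (by omega)
  have h3 : v ∈ LinearMap.ker M.mulVecLin := by simpa using hv
  rw [h2] at h3
  simpa using h3

theorem Matrix.rank_eq_card_of_mulVec {ι κ : Type*} [Fintype ι] [Fintype κ] {M : Matrix ι κ ℝ}
    (h : ∀ v : κ → ℝ, M *ᵥ v = 0 → v = 0) : M.rank = Fintype.card κ := by
  have h1 := LinearMap.finrank_range_add_finrank_ker M.mulVecLin
  have h2 : LinearMap.ker M.mulVecLin = ⊥ := by
    rw [LinearMap.ker_eq_bot']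
    intro v hv
    exact h v (by simpa using hv)
  rw [h2, finrank_bot, add_zero, Module.finrank_fintype_fun_eq_card] at h1
  exact h1

theorem Matrix.exists_mulVec_eq_of_vecMul {ι κ : Type*} [Fintype ι] [Fintype κ]
    {M : Matrix ι κ ℝ} (h : ∀ v : ι → ℝ, v ᵥ* M = 0 → v = 0) (w : ι → ℝ) :
    ∃ g, M *ᵥ g = w := by
  have h1 : Mᵀ.rank = Fintype.card ι :=
    Matrix.rank_eq_card_of_mulVec fun v hv => h v (by rwa [Matrix.mulVec_transpose] at hv)
  rw [Matrix.rank_transpose] at h1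
  have h2 : LinearMap.range M.mulVecLin = ⊤ := by
    apply Submodule.eq_top_of_finrank_eq
    rw [Module.finrank_fintype_fun_eq_card]
    exact h1
  obtain ⟨g, hg⟩ := LinearMap.range_eq_top.mp h2 w
  exact ⟨g, hg⟩

/-- A linear function of the powers of a matrix that vanishes on the first `n` of them vanishes
on all of them. -/
theorem Matrix.map_pow_eq_zero {n : ℕ} {E : Type*} [AddCommGroup E] [Module ℝ E]
    (A : Matrix (Fin n) (Fin n) ℝ) (f : Matrix (Fin n) (Fin n) ℝ →ₗ[ℝ] E)
    (h : ∀ k < n, f (A ^ k) = 0) (k : ℕ) : f (A ^ k) = 0 := by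
  rw [Matrix.pow_eq_aeval_mod_charpoly, Polynomial.aeval_eq_sum_range, map_sum]
  refine Finset.sum_eq_zero fun i hi => ?_
  rw [map_smul]
  by_cases hin : i < n
  · rw [h i hin, smul_zero]
  · rw [Polynomial.coeff_eq_zero_of_degree_lt, zero_smul]
    refine (Polynomial.degree_modByMonic_lt _ A.charpoly_monic).trans_le ?_
    rw [A.charpoly_degree_eq_dim, Fintype.card_fin]
    exact_mod_cast not_lt.mp hin

/-! ### State and output as linear functions of initial state and input. -/

namespace StateSpace

variable {n m : ℕ}

/-- The state at time `k`, as a function of the initial state and the input. -/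
noncomputable def stateMap (S : StateSpace n m) :
    ℕ → ((Fin n → ℝ) × (ℕ → Fin m → ℝ)) →ₗ[ℝ] (Fin n → ℝ)
  | 0 => LinearMap.fst ℝ _ _
  | k + 1 => S.A.mulVecLin ∘ₗ S.stateMap k
      + S.B.mulVecLin ∘ₗ LinearMap.proj k ∘ₗ LinearMap.snd ℝ _ _

/-- The output at time `k`, as a function of the initial state and the input. -/
noncomputable def outMap (S : StateSpace n m) (k : ℕ) :
    ((Fin n → ℝ) × (ℕ → Fin m → ℝ)) →ₗ[ℝ] (Fin m → ℝ) :=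
  S.C.mulVecLin ∘ₗ S.stateMap k + S.D.mulVecLin ∘ₗ LinearMap.proj k ∘ₗ LinearMap.snd ℝ _ _

variable (S : StateSpace n m)

@[simp] theorem stateMap_zero (z : (Fin n → ℝ) × (ℕ → Fin m → ℝ)) : S.stateMap 0 z = z.1 := rfl

theorem stateMap_succ (k : ℕ) (z : (Fin n → ℝ) × (ℕ → Fin m → ℝ)) :
    S.stateMap (k + 1) z = S.A *ᵥ S.stateMap k z + S.B *ᵥ z.2 k := rfl

theorem outMap_apply (k : ℕ) (z : (Fin n → ℝ) × (ℕ → Fin m → ℝ)) :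
    S.outMap k z = S.C *ᵥ S.stateMap k z + S.D *ᵥ z.2 k := rfl

theorem stateMap_add (T k : ℕ) (z : (Fin n → ℝ) × (ℕ → Fin m → ℝ)) :
    S.stateMap (T + k) z = S.stateMap k (S.stateMap T z, fun i => z.2 (T + i)) := by
  induction k with
  | zero => rfl
  | succ k ih => rw [← add_assoc, stateMap_succ, ih, stateMap_succ]

theorem outMap_add (T k : ℕ) (z : (Fin n → ℝ) × (ℕ → Fin m → ℝ)) :
    S.outMap (T + k) z = S.outMap k (S.stateMap T z, fun i => z.2 (T + i)) := by
  rw [outMap_apply, stateMap_add, outMap_apply]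

theorem stateMap_congr {k : ℕ} {x : Fin n → ℝ} {u v : ℕ → Fin m → ℝ} (h : ∀ i < k, u i = v i) :
    S.stateMap k (x, u) = S.stateMap k (x, v) := by
  induction k with
  | zero => rfl
  | succ k ih =>
    rw [stateMap_succ, stateMap_succ, ih fun i hi => h i (by omega)]
    simp [h k (by omega)]

theorem outMap_congr {k : ℕ} {x : Fin n → ℝ} {u v : ℕ → Fin m → ℝ} (h : ∀ i ≤ k, u i = v i) :
    S.outMap k (x, u) = S.outMap k (x, v) := by
  rw [outMap_apply, outMap_apply, S.stateMap_congr fun i hi => h i hi.le]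
  simp [h k le_rfl]

theorem stateMap_zero_input (k : ℕ) (x : Fin n → ℝ) :
    S.stateMap k (x, 0) = (S.A ^ k) *ᵥ x := by
  induction k with
  | zero => simp
  | succ k ih => rw [stateMap_succ, ih, pow_succ', Matrix.mulVec_mulVec]; simp

theorem stateMap_eq_sum (k : ℕ) (u : ℕ → Fin m → ℝ) :
    S.stateMap k (0, u) = ∑ i ∈ Finset.range k, (S.A ^ (k - 1 - i) * S.B) *ᵥ u i := by
  induction k with
  | zero => simp
  | succ k ih =>
    rw [stateMap_succ, ih, Finset.sum_range_succ, Matrix.mulVec_sum]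
    congr 1
    · refine Finset.sum_congr rfl fun i hi => ?_
      have := Finset.mem_range.mp hi
      rw [Matrix.mulVec_mulVec, ← Matrix.mul_assoc, ← pow_succ']
      congr 3
      omega
    · simp

theorem outMap_eq_sum (k : ℕ) (u : ℕ → Fin m → ℝ) :
    S.outMap k (0, u) = (∑ i ∈ Finset.range k, (S.C * S.A ^ (k - 1 - i) * S.B) *ᵥ u i)
      + S.D *ᵥ u k := by
  rw [outMap_apply, stateMap_eq_sum, Matrix.mulVec_sum]
  simp [Matrix.mulVec_mulVec, Matrix.mul_assoc]

end StateSpace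

/-- The input `v` on `[0, T)`, followed by the input `u`. -/
def seqAppend {m : ℕ} (T : ℕ) (v u : ℕ → Fin m → ℝ) : ℕ → Fin m → ℝ :=
  fun k => if k < T then v k else u (k - T)

theorem seqAppend_of_lt {m T k : ℕ} {v u : ℕ → Fin m → ℝ} (h : k < T) :
    seqAppend T v u k = v k := if_pos h

@[simp] theorem seqAppend_add {m T k : ℕ} {v u : ℕ → Fin m → ℝ} :
    seqAppend T v u (T + k) = u k := by simp [seqAppend]

/-! ### Minimality, controllability and observability. -/

namespace StateSpace

variable {n m : ℕ} (S : StateSpace n m)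

theorem stateMap_append_of_le {T k : ℕ} (h : k ≤ T) (x : Fin n → ℝ) (v u : ℕ → Fin m → ℝ) :
    S.stateMap k (x, seqAppend T v u) = S.stateMap k (x, v) :=
  S.stateMap_congr fun _ hi => seqAppend_of_lt (by omega)

theorem outMap_append_of_lt {T k : ℕ} (h : k < T) (x : Fin n → ℝ) (v u : ℕ → Fin m → ℝ) :
    S.outMap k (x, seqAppend T v u) = S.outMap k (x, v) :=
  S.outMap_congr fun _ hi => seqAppend_of_lt (by omega)

theorem stateMap_append_add (T k : ℕ) (x : Fin n → ℝ) (v u : ℕ → Fin m → ℝ) :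
    S.stateMap (T + k) (x, seqAppend T v u) = S.stateMap k (S.stateMap T (x, v), u) := by
  rw [stateMap_add, S.stateMap_append_of_le le_rfl]
  simp

theorem outMap_append_add (T k : ℕ) (x : Fin n → ℝ) (v u : ℕ → Fin m → ℝ) :
    S.outMap (T + k) (x, seqAppend T v u) = S.outMap k (S.stateMap T (x, v), u) := by
  rw [outMap_add, S.stateMap_append_of_le le_rfl]
  simp

/-- States reachable from zero at time `T`. -/
noncomputable def reachAt (T : ℕ) : Submodule ℝ (Fin n → ℝ) :=
  LinearMap.range (S.stateMap T ∘ₗ LinearMap.inr ℝ _ _)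

theorem mem_reachAt {T : ℕ} {x : Fin n → ℝ} :
    x ∈ S.reachAt T ↔ ∃ u, S.stateMap T (0, u) = x := by
  simp [reachAt]

theorem reachAt_mono : Monotone S.reachAt := by
  refine monotone_nat_of_le_succ fun T x hx => ?_
  obtain ⟨u, rfl⟩ := S.mem_reachAt.mp hx
  refine S.mem_reachAt.mpr ⟨seqAppend 1 0 u, ?_⟩
  rw [add_comm T 1, stateMap_append_add]
  congr 2
  rw [stateMap_succ]
  simp

theorem exists_iSup_reachAt_eq : ∃ T, ⨆ k, S.reachAt k = S.reachAt T := by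
  obtain ⟨T, hT⟩ := monotone_stabilizes_iff_noetherian.mpr
    (inferInstance : IsNoetherian ℝ (Fin n → ℝ)) ⟨S.reachAt, S.reachAt_mono⟩
  refine ⟨T, le_antisymm (iSup_le fun k => ?_) (le_iSup S.reachAt T)⟩
  rcases le_total T k with h | h
  · exact (hT k h).ge
  · exact S.reachAt_mono h

/-- The system is Markov-minimal if no realisation of the same Markov parameters has fewer
states. -/
def MarkovMinimal (S : StateSpace n m) : Prop :=
  ∀ (n' : ℕ) (S' : StateSpace n' m), S'.D = S.D →
    (∀ k, S'.C * S'.A ^ k * S'.B = S.C * S.A ^ k * S.B) → n ≤ n'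

/-- The response depends only on `D` and the Markov parameters. In this form minimality passes to
the transposed system, so that observability follows from controllability. -/
theorem IsMinimal.markovMinimal {S : StateSpace n m} (hS : S.IsMinimal) : S.MarkovMinimal := by
  intro n' S' hD hM
  refine hS n' S' ?_
  apply LinearMap.ext
  intro u
  funext j
  change (∑ i ∈ Finset.range j, complexAct (S'.C * S'.A ^ (j - 1 - i) * S'.B) (u i))
      + complexAct S'.D (u j) = (∑ i ∈ Finset.range j,
      complexAct (S.C * S.A ^ (j - 1 - i) * S.B) (u i)) + complexAct S.D (u j)
  simp only [hM, hD]

/-- The dual system. -/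
def dual (S : StateSpace n m) : StateSpace n m := ⟨S.Aᵀ, S.Cᵀ, S.Bᵀ, S.Dᵀ⟩

theorem markov_dual (k : ℕ) : S.dual.C * S.dual.A ^ k * S.dual.B = (S.C * S.A ^ k * S.B)ᵀ := by
  simp [dual, Matrix.transpose_mul, Matrix.transpose_pow, Matrix.mul_assoc]

theorem MarkovMinimal.dual {S : StateSpace n m} (hS : S.MarkovMinimal) :
    S.dual.MarkovMinimal := by
  intro n' S' hD hM
  refine hS n' S'.dual ?_ fun k => ?_
  · change S'.Dᵀ = S.D
    rw [hD]
    exact Matrix.transpose_transpose _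
  · rw [markov_dual, hM, markov_dual, Matrix.transpose_transpose]

/-- Restriction of a system to an invariant subspace containing the image of the input map. -/
theorem exists_restriction (R : Submodule ℝ (Fin n → ℝ))
    (hA : ∀ x ∈ R, S.A *ᵥ x ∈ R) (hB : ∀ v, S.B *ᵥ v ∈ R) :
    ∃ S' : StateSpace (Module.finrank ℝ R) m, S'.D = S.D ∧
      ∀ k, S'.C * S'.A ^ k * S'.B = S.C * S.A ^ k * S.B := by
  let e : R ≃ₗ[ℝ] (Fin (Module.finrank ℝ R) → ℝ) := (Module.finBasis ℝ R).equivFun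
  let ι : Matrix (Fin n) (Fin (Module.finrank ℝ R)) ℝ :=
    LinearMap.toMatrix' (R.subtype ∘ₗ e.symm.toLinearMap)
  let A' := LinearMap.toMatrix' (e.toLinearMap ∘ₗ (S.A.mulVecLin.restrict hA)
    ∘ₗ e.symm.toLinearMap)
  let B' := LinearMap.toMatrix' (e.toLinearMap ∘ₗ (S.B.mulVecLin.codRestrict R hB))
  have hι : ∀ v, ι *ᵥ v = e.symm v := fun v => by simp [ι, LinearMap.toMatrix'_mulVec]
  have hAι : ι * A' = S.A * ι := by
    apply Matrix.ext_of_mulVec_single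
    intro i
    rw [← Matrix.mulVec_mulVec, ← Matrix.mulVec_mulVec, hι, hι, LinearMap.toMatrix'_mulVec]
    simp only [LinearMap.comp_apply, LinearEquiv.coe_coe, LinearEquiv.symm_apply_apply]
    rfl
  have hBι : ι * B' = S.B := by
    apply Matrix.ext_of_mulVec_single
    intro i
    rw [← Matrix.mulVec_mulVec, hι, LinearMap.toMatrix'_mulVec]
    simp only [LinearMap.comp_apply, LinearEquiv.coe_coe, LinearEquiv.symm_apply_apply]
    rfl
  have hpow : ∀ k, ι * A' ^ k = S.A ^ k * ι := by
    intro k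
    induction k with
    | zero => simp
    | succ k ih => rw [pow_succ, ← Matrix.mul_assoc, ih, Matrix.mul_assoc, hAι, pow_succ,
        Matrix.mul_assoc]
  refine ⟨⟨A', B', S.C * ι, S.D⟩, rfl, fun k => ?_⟩
  change S.C * ι * A' ^ k * B' = _
  rw [Matrix.mul_assoc S.C, hpow, Matrix.mul_assoc, Matrix.mul_assoc, hBι, ← Matrix.mul_assoc]

/-- The reachable subspace is `A`-invariant and contains the image of `B`. Restricting to it keeps
the Markov parameters, so minimality leaves no room for a proper subspace. -/
theorem MarkovMinimal.exists_reachAt_eq_top {S : StateSpace n m} (hS : S.MarkovMinimal) :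
    ∃ T, S.reachAt T = ⊤ := by
  obtain ⟨T, hT⟩ := S.exists_iSup_reachAt_eq
  have hle : ∀ k, S.reachAt k ≤ S.reachAt T := fun k => hT ▸ le_iSup S.reachAt k
  obtain ⟨S', hD, hM⟩ := S.exists_restriction (S.reachAt T) (fun x hx => by
    obtain ⟨u, rfl⟩ := S.mem_reachAt.mp hx
    refine hle (T + 1) (S.mem_reachAt.mpr ⟨seqAppend T u 0, ?_⟩)
    rw [stateMap_append_add, stateMap_zero_input, pow_one]) (fun v => by
    refine hle 1 (S.mem_reachAt.mpr ⟨fun _ => v, ?_⟩)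
    simp [stateMap_succ])
  refine ⟨T, Submodule.eq_top_of_finrank_eq (le_antisymm (Submodule.finrank_le _) ?_)⟩
  rw [Module.finrank_fintype_fun_eq_card, Fintype.card_fin]
  exact hS _ S' hD hM

/-- States reached from zero are sums of vectors in the images of `A^i B`. The extra power `A^s` is
what lets the induction on `T` close. -/
theorem dotProduct_stateMap_eq_zero {ξ : Fin n → ℝ} (h : ∀ s, ξ ᵥ* (S.A ^ s * S.B) = 0)
    (T s : ℕ) (u : ℕ → Fin m → ℝ) : ξ ⬝ᵥ (S.A ^ s *ᵥ S.stateMap T (0, u)) = 0 := by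
  induction T generalizing s with
  | zero => simp
  | succ T ih =>
    rw [stateMap_succ, Matrix.mulVec_add, dotProduct_add, Matrix.mulVec_mulVec, ← pow_succ, ih,
      Matrix.mulVec_mulVec, Matrix.dotProduct_mulVec, h]
    simp

/-- Such a `ξ` is orthogonal to all reachable states, and it is itself reachable. -/
theorem MarkovMinimal.eq_zero_of_vecMul {S : StateSpace n m} (hS : S.MarkovMinimal)
    {ξ : Fin n → ℝ} (h : ∀ s, ξ ᵥ* (S.A ^ s * S.B) = 0) : ξ = 0 := by
  obtain ⟨T, hT⟩ := hS.exists_reachAt_eq_top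
  obtain ⟨u, hu⟩ := S.mem_reachAt.mp (hT ▸ Submodule.mem_top : ξ ∈ S.reachAt T)
  have := S.dotProduct_stateMap_eq_zero h T 0 u
  rw [hu, pow_zero, Matrix.one_mulVec] at this
  exact dotProduct_self_eq_zero.mp this

theorem MarkovMinimal.eq_zero_of_mulVec {S : StateSpace n m} (hS : S.MarkovMinimal)
    {x : Fin n → ℝ} (h : ∀ s, (S.C * S.A ^ s) *ᵥ x = 0) : x = 0 := by
  refine hS.dual.eq_zero_of_vecMul fun s => ?_
  change x ᵥ* (S.Aᵀ ^ s * S.Cᵀ) = 0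
  rw [← Matrix.transpose_pow, ← Matrix.transpose_mul, Matrix.vecMul_transpose, h]

theorem obsMatrix_mulVec_eq_zero_iff {l : ℕ} {x : Fin n → ℝ} :
    S.obsMatrix l *ᵥ x = 0 ↔ ∀ s < l, (S.C * S.A ^ s) *ᵥ x = 0 := by
  constructor
  · intro h s hs
    funext a
    exact congrFun h (⟨s, hs⟩, a)
  · intro h
    funext p
    exact congrFun (h p.1 p.1.2) p.2

/-- Zero output under zero input for at least as many steps as the lag forces the initial state
of a minimal system to vanish. -/
theorem MarkovMinimal.eq_zero_of_lag_le {S : StateSpace n m} (hS : S.MarkovMinimal) {l : ℕ}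
    (hl : S.lag ≤ l) {x : Fin n → ℝ} (h : ∀ s < l, (S.C * S.A ^ s) *ᵥ x = 0) : x = 0 := by
  have hne : {l : ℕ | 1 ≤ l ∧ (S.obsMatrix l).rank = n}.Nonempty := by
    -- Length `n` would do for the rank by Cayley–Hamilton, but the lag is at least `1` and `n` may
    -- be `0`.
    refine ⟨n + 1, by omega, ?_⟩
    conv_rhs => rw [← Fintype.card_fin n]
    refine Matrix.rank_eq_card_of_mulVec fun v hv => hS.eq_zero_of_mulVec ?_
    rw [obsMatrix_mulVec_eq_zero_iff] at hv
    let f : Matrix (Fin n) (Fin n) ℝ →ₗ[ℝ] (Fin m → ℝ) :=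
      { toFun := fun M => S.C *ᵥ (M *ᵥ v)
        map_add' := fun M M' => by rw [Matrix.add_mulVec, Matrix.mulVec_add]
        map_smul' := fun c M => by rw [Matrix.smul_mulVec, Matrix.mulVec_smul]; rfl }
    intro s
    rw [← Matrix.mulVec_mulVec]
    refine S.A.map_pow_eq_zero f (fun k hk => ?_) s
    change S.C *ᵥ (S.A ^ k *ᵥ v) = 0
    rw [Matrix.mulVec_mulVec]
    exact hv k (by omega)
  have hrank := (Nat.sInf_mem hne).2
  refine Matrix.mulVec_eq_zero_of_rank (M := S.obsMatrix S.lag) ?_ ?_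
  · rw [Fintype.card_fin]
    exact hrank
  · rw [obsMatrix_mulVec_eq_zero_iff]
    exact fun s hs => h s (by omega)

end StateSpace

/-! ### Persistency of excitation and the fundamental lemma. -/

/-- Full row rank of the Hankel matrix means that its left kernel is trivial. -/
theorem PersistentlyExciting.eq_zero_of_forall_sum {m N L : ℕ} {u : ℕ → Fin m → ℝ}
    (hu : PersistentlyExciting N u L) {c : ℕ → Fin m → ℝ}
    (h : ∀ j < N + 1 - L, ∑ t ∈ Finset.range L, c t ⬝ᵥ u (j + t) = 0) {t : ℕ} (ht : t < L) :
    c t = 0 := by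
  have hr : (hankel N u L)ᵀ.rank = Fintype.card (Fin L × Fin m) := by
    rw [Matrix.rank_transpose, hu, Fintype.card_prod, Fintype.card_fin, Fintype.card_fin, mul_comm]
  have hz := Matrix.mulVec_eq_zero_of_rank hr (v := fun p => c p.1 p.2) (by
    funext j
    have hj := h j j.2
    rw [Finset.sum_range] at hj
    simp only [Matrix.mulVec, dotProduct, Fintype.sum_prod_type, Matrix.transpose_apply, hankel,
      Matrix.of_apply, Pi.zero_apply]
    simp only [dotProduct] at hj
    rw [← hj]
    refine Finset.sum_congr rfl fun i _ => Finset.sum_congr rfl fun a _ => ?_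
    rw [mul_comm, add_comm])
  funext a
  exact congrFun hz (⟨t, ht⟩, a)

namespace StateSpace

variable {n m : ℕ} (S : StateSpace n m)

theorem stateMap_eq_pow_add (k : ℕ) (x : Fin n → ℝ) (u : ℕ → Fin m → ℝ) :
    S.stateMap k (x, u) = S.A ^ k *ᵥ x + S.stateMap k (0, u) := by
  rw [← stateMap_zero_input, ← map_add]
  simp

theorem eq_stateMap {N : ℕ} {x : ℕ → Fin n → ℝ} {u : ℕ → Fin m → ℝ}
    (hx : ∀ k < N, x (k + 1) = S.A *ᵥ x k + S.B *ᵥ u k) {j k : ℕ} (h : j + k ≤ N) :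
    x (j + k) = S.stateMap k (x j, fun i => u (j + i)) := by
  induction k with
  | zero => rfl
  | succ k ih => rw [← add_assoc, hx _ (by omega), ih (by omega), stateMap_succ]

/-- A linear functional that annihilates all data windows (initial state and `l + 1` inputs)
vanishes. -/
theorem eq_zero_of_annihilates_windows
    (hS : ∀ ξ : Fin n → ℝ, (∀ s, ξ ᵥ* (S.A ^ s * S.B) = 0) → ξ = 0) {N l : ℕ}
    {x : ℕ → Fin n → ℝ} {u : ℕ → Fin m → ℝ} (hu : PersistentlyExciting N u (n + l + 1))
    (hx : ∀ k < N, x (k + 1) = S.A *ᵥ x k + S.B *ᵥ u k) {ξ : Fin n → ℝ} {η : ℕ → Fin m → ℝ}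
    (h : ∀ j < N - l, ξ ⬝ᵥ x j + ∑ i ∈ Finset.range (l + 1), η i ⬝ᵥ u (j + i) = 0) :
    ξ = 0 ∧ ∀ i < l + 1, η i = 0 := by
  -- The functional on the window at `j + k`, with the state there expressed through `x j`, has
  -- coefficient `coef k t` at the input `u (j + t)`; only `ξ A^k` remains on `x j`.
  let coef : ℕ → ℕ → Fin m → ℝ := fun k t =>
    if t < k then ξ ᵥ* (S.A ^ (k - 1 - t) * S.B) else if t - k < l + 1 then η (t - k) else 0
  have step1 : ∀ k ≤ n, ∀ j < N - l - n,
      ξ ⬝ᵥ (S.A ^ k *ᵥ x j) + ∑ t ∈ Finset.range (n + l + 1), coef k t ⬝ᵥ u (j + t) = 0 := by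
    intro k hk j hj
    rw [← h (j + k) (by omega), S.eq_stateMap hx (by omega), stateMap_eq_pow_add, dotProduct_add,
      stateMap_eq_sum, dotProduct_sum, show n + l + 1 = k + ((l + 1) + (n - k)) by omega,
      Finset.sum_range_add, Finset.sum_range_add, add_assoc]
    congr 1
    have h1 : ∑ t ∈ Finset.range k, coef k t ⬝ᵥ u (j + t) = ∑ i ∈ Finset.range k,
        ξ ⬝ᵥ ((S.A ^ (k - 1 - i) * S.B) *ᵥ u (j + i)) := by
      refine Finset.sum_congr rfl fun t ht => ?_
      simp only [coef]
      rw [if_pos (Finset.mem_range.mp ht), Matrix.dotProduct_mulVec]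
    have h2 : ∑ t ∈ Finset.range (l + 1), coef k (k + t) ⬝ᵥ u (j + (k + t))
        = ∑ i ∈ Finset.range (l + 1), η i ⬝ᵥ u (j + k + i) := by
      refine Finset.sum_congr rfl fun t ht => ?_
      have := Finset.mem_range.mp ht
      simp only [coef]
      rw [if_neg (by omega), if_pos (by omega), Nat.add_sub_cancel_left, add_assoc]
    have h3 : ∑ t ∈ Finset.range (n - k),
        coef k (k + (l + 1 + t)) ⬝ᵥ u (j + (k + (l + 1 + t))) = 0 := by
      refine Finset.sum_eq_zero fun t ht => ?_
      simp only [coef]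
      rw [if_neg (by omega), if_neg (by omega), zero_dotProduct]
    rw [h1, h2, h3, add_zero]
  have hmonic : S.A.charpoly.coeff n = 1 := by
    have := S.A.charpoly_monic.coeff_natDegree
    rwa [S.A.charpoly_natDegree_eq_dim, Fintype.card_fin] at this
  -- Weighting the relations for `k = 0, …, n` by the coefficients of the characteristic polynomial
  -- removes `x j` by Cayley–Hamilton. A relation among `n + l + 1` consecutive inputs is left, and
  -- excitation kills it.
  have step2 : ∀ t < n + l + 1,
      ∑ k ∈ Finset.range (n + 1), S.A.charpoly.coeff k • coef k t = 0 := by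
    intro t ht
    refine hu.eq_zero_of_forall_sum
      (c := fun t => ∑ k ∈ Finset.range (n + 1), S.A.charpoly.coeff k • coef k t) ?_ ht
    intro j hj
    have hch : ∑ k ∈ Finset.range (n + 1), S.A.charpoly.coeff k • S.A ^ k = 0 := by
      have := S.A.aeval_self_charpoly
      rwa [Polynomial.aeval_eq_sum_range, S.A.charpoly_natDegree_eq_dim, Fintype.card_fin] at this
    have h0 : ∑ k ∈ Finset.range (n + 1), S.A.charpoly.coeff k * (ξ ⬝ᵥ (S.A ^ k *ᵥ x j)) = 0 := by
      have : ξ ⬝ᵥ ((∑ k ∈ Finset.range (n + 1), S.A.charpoly.coeff k • S.A ^ k) *ᵥ x j) = 0 := by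
        rw [hch]; simp
      rw [Matrix.sum_mulVec, dotProduct_sum] at this
      simpa [Matrix.smul_mulVec] using this
    have h1 : ∑ k ∈ Finset.range (n + 1), S.A.charpoly.coeff k * (ξ ⬝ᵥ (S.A ^ k *ᵥ x j)
        + ∑ t ∈ Finset.range (n + l + 1), coef k t ⬝ᵥ u (j + t)) = 0 :=
      Finset.sum_eq_zero fun k hk => by
        rw [step1 k (by simpa [Nat.lt_succ_iff] using hk) j (by omega), mul_zero]
    simp only [mul_add, Finset.sum_add_distrib, h0, zero_add, Finset.mul_sum] at h1
    rw [Finset.sum_comm] at h1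
    rw [← h1]
    refine Finset.sum_congr rfl fun t _ => ?_
    rw [sum_dotProduct]
    simp
  -- The coefficients depend only on the difference of their indices: `coef k t = d (l + k - t)`,
  -- and zero when `t > l + k`.
  let d : ℕ → Fin m → ℝ := fun s =>
    if s < l + 1 then η (l - s) else ξ ᵥ* (S.A ^ (s - (l + 1)) * S.B)
  have step3 : ∀ s, s < n + l + 1 → d s = 0 := by
    intro s
    induction s using Nat.strong_induction_on with
    | _ s ih =>
    intro hs
    have hcoef : ∀ k ≤ n, coef k (n + l - s) = if n ≤ s + k then d (s + k - n) else 0 := by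
      intro k hk
      simp only [coef, d]
      by_cases h1 : n + l - s < k
      · rw [if_pos h1, if_pos (by omega), if_neg (by omega)]
        congr 3
        omega
      · rw [if_neg h1]
        by_cases h2 : n + l - s - k < l + 1
        · rw [if_pos h2, if_pos (by omega), if_pos (by omega)]
          congr 1
          omega
        · rw [if_neg h2, if_neg (by omega)]
    -- The system is triangular: `d s` occurs at `k = n` with the leading coefficient `1`, and
    -- smaller `k` give earlier entries of `d` or zero.
    have h1 := step2 (n + l - s) (by omega)
    rw [Finset.sum_range_succ, hcoef n le_rfl, hmonic, one_smul, if_pos (by omega),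
      Nat.add_sub_cancel, Finset.sum_eq_zero, zero_add] at h1
    · exact h1
    · intro k hk
      have hk' := Finset.mem_range.mp hk
      rw [hcoef k hk'.le]
      split_ifs with h2
      · rw [ih _ (by omega) (by omega), smul_zero]
      · rw [smul_zero]
  constructor
  · refine hS ξ ?_
    let f : Matrix (Fin n) (Fin n) ℝ →ₗ[ℝ] (Fin m → ℝ) :=
      { toFun := fun M => ξ ᵥ* (M * S.B)
        map_add' := fun M M' => by rw [Matrix.add_mul, Matrix.vecMul_add]
        map_smul' := fun c M => by rw [Matrix.smul_mul, Matrix.vecMul_smul]; rfl }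
    refine S.A.map_pow_eq_zero f fun k hk => ?_
    have := step3 (k + (l + 1)) (by omega)
    simp only [d] at this
    rwa [if_neg (by omega), Nat.add_sub_cancel] at this
  · intro i hi
    have := step3 (l - i) (by omega)
    simp only [d] at this
    rwa [if_pos (by omega), Nat.sub_sub_self (by omega)] at this

/-- Every initial state and every `l + 1` inputs are a linear combination of data windows. -/
theorem exists_window_combination
    (hS : ∀ ξ : Fin n → ℝ, (∀ s, ξ ᵥ* (S.A ^ s * S.B) = 0) → ξ = 0) {N l : ℕ}
    {x : ℕ → Fin n → ℝ} {u : ℕ → Fin m → ℝ} (hu : PersistentlyExciting N u (n + l + 1))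
    (hx : ∀ k < N, x (k + 1) = S.A *ᵥ x k + S.B *ᵥ u k)
    (x₀ : Fin n → ℝ) (v : ℕ → Fin m → ℝ) :
    ∃ g : Fin (N - l) → ℝ, ∑ j, g j • x j = x₀ ∧
      ∀ i < l + 1, ∑ j, g j • u (j + i) = v i := by
  let M : Matrix (Fin n ⊕ (Fin (l + 1) × Fin m)) (Fin (N - l)) ℝ :=
    Matrix.of fun p j => Sum.elim (fun a => x j a) (fun q => u (j + q.1) q.2) p
  have hM : ∀ w : Fin n ⊕ (Fin (l + 1) × Fin m) → ℝ, w ᵥ* M = 0 → w = 0 := by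
    intro w hw
    let η : ℕ → Fin m → ℝ := fun i a => if hi : i < l + 1 then w (Sum.inr (⟨i, hi⟩, a)) else 0
    obtain ⟨h1, h2⟩ := S.eq_zero_of_annihilates_windows hS hu hx
      (ξ := fun a => w (Sum.inl a)) (η := η) (by
        intro j hj
        have := congrFun hw ⟨j, hj⟩
        simp only [Matrix.vecMul, dotProduct, Fintype.sum_sum_type, M, Matrix.of_apply,
          Sum.elim_inl, Sum.elim_inr, Fintype.sum_prod_type, Pi.zero_apply] at this
        rw [← this, Finset.sum_range]
        simp only [dotProduct, η, Fin.is_lt, dif_pos])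
    funext p
    rcases p with a | ⟨i, a⟩
    · exact congrFun h1 a
    · have := congrFun (h2 i i.2) a
      simp only [η, Fin.is_lt, dif_pos] at this
      exact this
  obtain ⟨g, hg⟩ := Matrix.exists_mulVec_eq_of_vecMul hM
    (Sum.elim x₀ fun q : Fin (l + 1) × Fin m => v q.1 q.2)
  refine ⟨g, ?_, fun i hi => ?_⟩
  · funext a
    have := congrFun hg (Sum.inl a)
    simpa [Matrix.mulVec, dotProduct, M, mul_comm] using this
  · funext a
    have := congrFun hg (Sum.inr (⟨i, hi⟩, a))
    simpa [Matrix.mulVec, dotProduct, M, mul_comm] using this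

end StateSpace

/-! ### Suprema of quadratic forms over linear fibres. -/

/-- On a symmetric interval a lower bound for an additive function is also an upper bound, by `t ↦
-t`. Boundedness near zero gives continuity, hence linearity. -/
theorem AddMonoidHom.eq_mul_of_bddBelow (f : ℝ →+ ℝ) {K : ℝ}
    (hK : ∀ t ∈ Set.Icc (-1 : ℝ) 1, K ≤ f t) (t : ℝ) : f t = t * f 1 := by
  have hc : Continuous f := by
    refine f.continuous_of_isBounded_nhds_zero
      (Icc_mem_nhds (by norm_num : (-1 : ℝ) < 0) (by norm_num : (0 : ℝ) < 1)) ?_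
    refine (Metric.isBounded_Icc K (-K)).subset ?_
    rintro _ ⟨s, hs, rfl⟩
    refine ⟨hK s hs, ?_⟩
    have := hK (-s) ⟨by linarith [hs.2], by linarith [hs.1]⟩
    rw [map_neg] at this
    linarith
  have := map_real_smul f hc t 1
  simpa using this

section Supremum

variable {X : Type*} [AddCommGroup X] [Module ℝ X] {F : X → Set ℝ}

/-- Combining near-optimal elements over `x` and `y` with coefficients `(1, 1)` and `(1, -1)`
cancels the cross term `s`. This is one half of the parallelogram law. -/
theorem le_sSup_add_sSup_sub (hne : ∀ x, (F x).Nonempty) (hbd : ∀ x, BddAbove (F x))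
    (hF : ∀ x y, ∀ c ∈ F x, ∀ d ∈ F y, ∃ s, ∀ a b : ℝ,
      a ^ 2 * c + a * b * s + b ^ 2 * d ∈ F (a • x + b • y)) (x y : X) :
    2 * sSup (F x) + 2 * sSup (F y) ≤ sSup (F (x + y)) + sSup (F (x - y)) := by
  have h1 : ∀ c ∈ F x, ∀ d ∈ F y, 2 * c + 2 * d ≤ sSup (F (x + y)) + sSup (F (x - y)) := by
    intro c hc d hd
    obtain ⟨s, hs⟩ := hF x y c hc d hd
    have h2 := hs 1 1
    have h3 := hs 1 (-1)
    rw [one_smul, one_smul] at h2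
    rw [one_smul, neg_one_smul, ← sub_eq_add_neg] at h3
    linarith [le_csSup (hbd _) h2, le_csSup (hbd _) h3]
  have h4 : ∀ d ∈ F y, 2 * sSup (F x) + 2 * d ≤ sSup (F (x + y)) + sSup (F (x - y)) := by
    intro d hd
    have : sSup (F x) ≤ (sSup (F (x + y)) + sSup (F (x - y)) - 2 * d) / 2 :=
      csSup_le (hne x) fun c hc => by linarith [h1 c hc d hd]
    linarith
  have : sSup (F y) ≤ (sSup (F (x + y)) + sSup (F (x - y)) - 2 * sSup (F x)) / 2 :=
    csSup_le (hne y) fun d hd => by linarith [h4 d hd]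
  linarith

/-- The supremum of a quadratic form over the fibres of a linear relation, if finite, is a
quadratic form. -/
theorem exists_quadraticForm_eq_sSup (hne : ∀ x, (F x).Nonempty) (hbd : ∀ x, BddAbove (F x))
    (hF : ∀ x y, ∀ c ∈ F x, ∀ d ∈ F y, ∃ s, ∀ a b : ℝ,
      a ^ 2 * c + a * b * s + b ^ 2 * d ∈ F (a • x + b • y)) :
    ∃ q : QuadraticForm ℝ X, ∀ x, q x = sSup (F x) := by
  set V : X → ℝ := fun x => sSup (F x) with hV
  have hle : ∀ x, ∀ c ∈ F x, c ≤ V x := fun x c hc => le_csSup (hbd x) hc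
  have hpar : ∀ x y, 2 * V x + 2 * V y ≤ V (x + y) + V (x - y) :=
    le_sSup_add_sSup_sub hne hbd hF
  have hmul : ∀ (t : ℝ) (x : X), ∀ c ∈ F x, t ^ 2 * c ∈ F (t • x) := by
    intro t x c hc
    obtain ⟨s, hs⟩ := hF x x c hc c hc
    simpa using hs t 0
  have hsmul_le : ∀ (t : ℝ) (x : X), t ≠ 0 → t ^ 2 * V x ≤ V (t • x) := by
    intro t x ht
    have ht2 : 0 < t ^ 2 := by positivity
    rw [mul_comm, ← le_div_iff₀ ht2]
    refine csSup_le (hne x) fun c hc => ?_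
    rw [le_div_iff₀ ht2, mul_comm]
    exact hle _ _ (hmul t x c hc)
  have hsmul' : ∀ (t : ℝ) (x : X), t ≠ 0 → V (t • x) = t ^ 2 * V x := by
    intro t x ht
    refine le_antisymm ?_ (hsmul_le t x ht)
    have h1 := hsmul_le t⁻¹ (t • x) (inv_ne_zero ht)
    rw [inv_smul_smul₀ ht, inv_pow] at h1
    have ht2 : 0 < t ^ 2 := by positivity
    rwa [inv_mul_le_iff₀ ht2] at h1
  have hpar' : ∀ x y, V (x + y) + V (x - y) = 2 * V x + 2 * V y := by
    intro x y
    refine le_antisymm ?_ (hpar x y)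
    -- The other half is the first one at `x + y` and `x - y`, with `V (2x) = 4 V x`.
    have h1 := hpar (x + y) (x - y)
    rw [show x + y + (x - y) = (2 : ℝ) • x by rw [two_smul]; abel,
      show x + y - (x - y) = (2 : ℝ) • y by rw [two_smul]; abel,
      hsmul' 2 x two_ne_zero, hsmul' 2 y two_ne_zero] at h1
    linarith
  have h0 : V 0 = 0 := by
    have := hpar' 0 0
    simp only [add_zero, sub_zero] at this
    linarith
  have hsmul : ∀ (t : ℝ) (x : X), V (t • x) = (t * t) • V x := by
    intro t x
    rcases eq_or_ne t 0 with rfl | ht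
    · simp [h0]
    · rw [hsmul' t x ht, smul_eq_mul, sq]
  -- The Jordan–von Neumann argument: additivity of the polar form from four instances of the
  -- parallelogram law.
  have hadd : ∀ x x' y : X, QuadraticMap.polar V (x + x') y
      = QuadraticMap.polar V x y + QuadraticMap.polar V x' y := by
    intro x z y
    have e1 := hpar' (x + y) z
    have e2 := hpar' x (y - z)
    have e3 := hpar' (x + z) y
    have e4 := hpar' y z
    rw [show x + (y - z) = x + y - z by abel, show x - (y - z) = x + z - y by abel] at e2
    rw [show x + z + y = x + y + z by abel] at e3
    simp only [QuadraticMap.polar, show x + z + y = x + y + z by abel]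
    rw [show z + y = y + z by abel]
    linarith
  have hlin : ∀ (a : ℝ) (x y : X), QuadraticMap.polar V (a • x) y
      = a • QuadraticMap.polar V x y := by
    intro a x y
    let f : ℝ →+ ℝ := AddMonoidHom.mk' (fun t => QuadraticMap.polar V (t • x) y) fun s t => by
      rw [add_smul, hadd]
    obtain ⟨c, hc⟩ := hne x
    obtain ⟨d, hd⟩ := hne y
    obtain ⟨s, hs⟩ := hF x y c hc d hd
    -- The lower bound comes from `V (t • x + y) ≥ t² c + t s + d` with `V (t • x) = t² V x`, where
    -- `|t| ≤ 1`.
    have hf := f.eq_mul_of_bddBelow (K := -(V x - c) - |s| + d - V y) (fun t ht => by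
      have h1 := hle _ _ (hs t 1)
      rw [one_smul] at h1
      change _ ≤ V (t • x + y) - V (t • x) - V y
      rw [hsmul, smul_eq_mul]
      have h2 : t ^ 2 ≤ 1 := by
        rw [sq_le_one_iff_abs_le_one]
        exact abs_le.mpr ht
      have h3 : -|s| ≤ t * s := by
        have h4 : |t * s| ≤ |s| := by
          rw [abs_mul]
          exact mul_le_of_le_one_left (abs_nonneg s) (abs_le.mpr ht)
        linarith [neg_abs_le (t * s)]
      have h5 : t ^ 2 * (V x - c) ≤ V x - c :=
        mul_le_of_le_one_left (by linarith [hle x c hc]) h2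
      nlinarith) a
    change QuadraticMap.polar V (a • x) y = a * QuadraticMap.polar V ((1 : ℝ) • x) y at hf
    rwa [one_smul] at hf
  exact ⟨QuadraticMap.ofPolar V hsmul hadd hlin, fun x => rfl⟩

end Supremum

theorem QuadraticForm.exists_matrix {n : ℕ} (q : QuadraticForm ℝ (Fin n → ℝ)) :
    ∃ Q : Matrix (Fin n) (Fin n) ℝ, Q.IsSymm ∧ ∀ x, x ⬝ᵥ Q *ᵥ x = q x := by
  refine ⟨q.toMatrix', QuadraticForm.isSymm_toMatrix' q, fun x => ?_⟩
  have h : QuadraticMap.associated (R := ℝ) q x x = q x := QuadraticMap.associated_eq_self_apply ℝ q x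
  rw [← h, ← Matrix.toLinearMap₂'_apply', QuadraticForm.toMatrix', Matrix.toLinearMap₂'_toMatrix']

/-! ### Supply rates and the construction of a quadratic storage function. -/

/-- The quadratic supply rate `a |y|² + b |u|²`. -/
def supply {m : ℕ} (a b : ℝ) (u y : Fin m → ℝ) : ℝ := a * (y ⬝ᵥ y) + b * (u ⬝ᵥ u)

theorem supply_combination {m : ℕ} (a b : ℝ) (u y u' y' : Fin m → ℝ) (α β : ℝ) :
    supply a b (α • u + β • u') (α • y + β • y') = α ^ 2 * supply a b u y
      + α * β * (2 * (a * (y ⬝ᵥ y') + b * (u ⬝ᵥ u'))) + β ^ 2 * supply a b u' y' := by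
  simp only [supply, add_dotProduct, dotProduct_add, smul_dotProduct, dotProduct_smul, smul_eq_mul,
    dotProduct_comm y' y, dotProduct_comm u' u]
  ring

namespace StateSpace

variable {n m : ℕ} (S : StateSpace n m)

/-- The total supply over `[0, T)` along a trajectory. -/
noncomputable def totalSupply (a b : ℝ) (T : ℕ) (x : Fin n → ℝ) (u : ℕ → Fin m → ℝ) : ℝ :=
  ∑ k ∈ Finset.range T, supply a b (u k) (S.outMap k (x, u))

theorem totalSupply_append (a b : ℝ) (T T' : ℕ) (x : Fin n → ℝ) (v u : ℕ → Fin m → ℝ) :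
    S.totalSupply a b (T + T') x (seqAppend T v u)
      = S.totalSupply a b T x v + S.totalSupply a b T' (S.stateMap T (x, v)) u := by
  rw [totalSupply, Finset.sum_range_add]
  congr 1
  · refine Finset.sum_congr rfl fun k hk => ?_
    rw [seqAppend_of_lt (Finset.mem_range.mp hk), S.outMap_append_of_lt (Finset.mem_range.mp hk)]
  · refine Finset.sum_congr rfl fun k _ => ?_
    rw [seqAppend_add, S.outMap_append_add]

/-- The storage function `xᵀ Q x` satisfies the dissipation inequality. -/
def IsStorage (a b : ℝ) (Q : Matrix (Fin n) (Fin n) ℝ) : Prop :=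
  ∀ x u, (S.A *ᵥ x + S.B *ᵥ u) ⬝ᵥ Q *ᵥ (S.A *ᵥ x + S.B *ᵥ u) - x ⬝ᵥ Q *ᵥ x
    + supply a b u (S.C *ᵥ x + S.D *ᵥ u) ≤ 0

/-- Supplies of the trajectories that start at `x` and eventually rest at zero. -/
def restSupplies (a b : ℝ) (x : Fin n → ℝ) : Set ℝ :=
  {c | ∃ u, ∀ᶠ T in atTop, 
    S.stateMap T (x, u) = 0 ∧ u T = 0 ∧ S.totalSupply a b T x u = c}

variable {S}

/-- If no cycle through the zero state has positive total supply, then a controllable system has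
a quadratic storage function. -/
theorem exists_isStorage {T₀ : ℕ} (hT₀ : S.reachAt T₀ = ⊤) {a b : ℝ}
    (hcyc : ∀ u T, S.stateMap T (0, u) = 0 → S.totalSupply a b T 0 u ≤ 0) :
    ∃ Q : Matrix (Fin n) (Fin n) ℝ, Q.IsSymm ∧ S.IsStorage a b Q := by
  have hreach : ∀ x, ∃ u, S.stateMap T₀ (0, u) = x := fun x =>
    S.mem_reachAt.mp (hT₀ ▸ Submodule.mem_top)
  have hne : ∀ x, (S.restSupplies a b x).Nonempty := by
    intro x
    obtain ⟨u, hu⟩ := hreach (-(S.A ^ T₀ *ᵥ x))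
    have h0 : S.stateMap T₀ (x, u) = 0 := by rw [stateMap_eq_pow_add, hu, add_neg_cancel]
    refine ⟨S.totalSupply a b T₀ x u, seqAppend T₀ u 0, ?_⟩
    filter_upwards [eventually_ge_atTop T₀] with T hT
    obtain ⟨k, rfl⟩ := Nat.exists_eq_add_of_le hT
    rw [stateMap_append_add, totalSupply_append, h0]
    have h1 : ∀ k, S.stateMap k ((0 : Fin n → ℝ), (0 : ℕ → Fin m → ℝ)) = 0 := fun k =>
      map_zero (S.stateMap k)
    have h2 : ∀ k, S.outMap k ((0 : Fin n → ℝ), (0 : ℕ → Fin m → ℝ)) = 0 := fun k =>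
      map_zero (S.outMap k)
    refine ⟨h1 k, by simp, ?_⟩
    simp [totalSupply, h2, supply]
  have hbd : ∀ x, BddAbove (S.restSupplies a b x) := by
    intro x
    obtain ⟨v, hv⟩ := hreach x
    refine ⟨-S.totalSupply a b T₀ 0 v, ?_⟩
    rintro c ⟨u, hu⟩
    obtain ⟨T, hT0, -, hTc⟩ := hu.exists
    -- Reaching `x` from zero by `v` and then following `u` is a cycle through zero, so the cost of
    -- `v` bounds every supply from `x`.
    have := hcyc (seqAppend T₀ v u) (T₀ + T) (by rw [stateMap_append_add, hv, hT0])
    rw [totalSupply_append, hv, hTc] at this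
    linarith
  have hcomb : ∀ x y, ∀ c ∈ S.restSupplies a b x, ∀ d ∈ S.restSupplies a b y, ∃ s, ∀ α β : ℝ,
      α ^ 2 * c + α * β * s + β ^ 2 * d ∈ S.restSupplies a b (α • x + β • y) := by
    rintro x y c ⟨u, hu⟩ d ⟨v, hv⟩
    obtain ⟨T₁, hT₁⟩ := eventually_atTop.mp (hu.and hv)
    let cross : ℕ → ℝ := fun T => ∑ k ∈ Finset.range T,
      2 * (a * (S.outMap k (x, u) ⬝ᵥ S.outMap k (y, v)) + b * (u k ⬝ᵥ v k))
    refine ⟨cross T₁, fun α β => ⟨α • u + β • v, ?_⟩⟩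
    have hz : ((α • x + β • y, α • u + β • v) : (Fin n → ℝ) × (ℕ → Fin m → ℝ))
        = α • (x, u) + β • (y, v) := rfl
    filter_upwards [eventually_ge_atTop T₁] with T hT
    obtain ⟨⟨hx, hu0, hc⟩, hy, hv0, hd⟩ := hT₁ T hT
    -- Both trajectories are at rest after `T₁`, so the mixed term no longer changes and serves as
    -- the `s` common to all `α`, `β`.
    have hcross : cross T = cross T₁ := by
      obtain ⟨k, rfl⟩ := Nat.exists_eq_add_of_le hT
      simp only [cross]
      rw [Finset.sum_range_add, add_eq_left]
      refine Finset.sum_eq_zero fun i _ => ?_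
      obtain ⟨⟨hx, hu0, -⟩, -⟩ := hT₁ (T₁ + i) (by omega)
      simp [outMap_apply, hx, hu0]
    refine ⟨?_, ?_, ?_⟩
    · rw [hz, map_add, map_smul, map_smul, hx, hy, smul_zero, smul_zero, add_zero]
    · simp [hu0, hv0]
    · rw [← hcross, ← hc, ← hd]
      simp only [totalSupply, cross, Finset.mul_sum, ← Finset.sum_add_distrib]
      refine Finset.sum_congr rfl fun k _ => ?_
      rw [hz, map_add, map_smul, map_smul, Pi.add_apply, Pi.smul_apply, Pi.smul_apply,
        supply_combination]
  obtain ⟨q, hq⟩ := exists_quadraticForm_eq_sSup hne hbd hcomb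
  obtain ⟨Q, hQs, hQ⟩ := q.exists_matrix
  refine ⟨Q, hQs, fun x u => ?_⟩
  rw [hQ, hQ, hq, hq]
  have : sSup (S.restSupplies a b (S.A *ᵥ x + S.B *ᵥ u))
      ≤ sSup (S.restSupplies a b x) - supply a b u (S.C *ᵥ x + S.D *ᵥ u) := by
    refine csSup_le (hne _) ?_
    rintro c ⟨v, hv⟩
    rw [le_sub_iff_add_le']
    -- Dynamic programming: one step with `u` followed by a trajectory to rest competes in the
    -- supremum at `x`.
    refine le_csSup (hbd x) ⟨seqAppend 1 (fun _ => u) v, ?_⟩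
    have h1 : S.stateMap 1 (x, fun _ => u) = S.A *ᵥ x + S.B *ᵥ u := rfl
    obtain ⟨T₁, hT₁⟩ := eventually_atTop.mp hv
    filter_upwards [eventually_ge_atTop (1 + T₁)] with T hT
    obtain ⟨k, rfl⟩ := Nat.exists_eq_add_of_le ((Nat.le_add_right 1 T₁).trans hT)
    obtain ⟨h2, h2', h3⟩ := hT₁ k (by omega)
    rw [stateMap_append_add, totalSupply_append, h1, h2, h3]
    refine ⟨rfl, by rw [seqAppend_add, h2'], ?_⟩
    simp [totalSupply, outMap_apply]
  linarith

end StateSpace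

/-! ### The extended state and nonnegativity of storage functions. -/

theorem LinearMap.exists_comp_eq_of_ker_le {K V W E : Type*} [Field K] [AddCommGroup V] [Module K V]
    [AddCommGroup W] [Module K W] [AddCommGroup E] [Module K E] {f : V →ₗ[K] W} {g : V →ₗ[K] E}
    (h : ∀ v, f v = 0 → g v = 0) : ∃ M : W →ₗ[K] E, ∀ v, M (f v) = g v := by
  obtain ⟨r, hr⟩ := f.rangeRestrict.exists_rightInverse_of_surjective f.range_rangeRestrict
  obtain ⟨M, hM⟩ := LinearMap.exists_extend (g ∘ₗ r)
  refine ⟨M, fun v => ?_⟩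
  have h1 := LinearMap.congr_fun hM (f.rangeRestrict v)
  have h2 := congrArg Subtype.val (LinearMap.congr_fun hr (f.rangeRestrict v))
  have h3 : f (r (f.rangeRestrict v)) = f v := h2
  have h4 := h (r (f.rangeRestrict v) - v) (by rw [map_sub, h3, sub_self])
  rw [map_sub, sub_eq_zero] at h4
  exact h1.trans h4

theorem tendsto_zero_of_dotProduct_self {ι : Type*} [Fintype ι] {v : ℕ → ι → ℝ}
    (h : Tendsto (fun k => v k ⬝ᵥ v k) atTop (𝓝 0)) : Tendsto v atTop (𝓝 0) := by
  rw [tendsto_pi_nhds]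
  intro a
  have h1 : Tendsto (fun k => √(v k ⬝ᵥ v k)) atTop (𝓝 0) := by
    simpa using h.sqrt
  refine squeeze_zero_norm (fun k => ?_) h1
  refine Real.abs_le_sqrt ?_
  rw [sq]
  exact Finset.single_le_sum (f := fun i => v k i * v k i) (fun i _ => mul_self_nonneg _)
    (Finset.mem_univ a)

theorem dotProduct_self_nonneg_real {ι : Type*} [Fintype ι] (v : ι → ℝ) : 0 ≤ v ⬝ᵥ v :=
  Finset.sum_nonneg fun _ _ => mul_self_nonneg _

theorem Matrix.tendsto_dotProduct_mulVec_zero {ι : Type*} [Fintype ι] (Q : Matrix ι ι ℝ)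
    {v : ℕ → ι → ℝ} (h : Tendsto v atTop (𝓝 0)) :
    Tendsto (fun k => v k ⬝ᵥ Q *ᵥ v k) atTop (𝓝 0) := by
  have hc : Continuous fun w : ι → ℝ => w ⬝ᵥ Q *ᵥ w := by fun_prop
  have h0 := (hc.tendsto 0).comp h
  rw [zero_dotProduct] at h0
  exact h0

theorem Matrix.posSemidef_iff_isSymm {ι : Type*} [Fintype ι] {Q : Matrix ι ι ℝ} :
    Q.PosSemidef ↔ Q.IsSymm ∧ ∀ x, 0 ≤ x ⬝ᵥ Q *ᵥ x := by
  rw [Matrix.posSemidef_iff_dotProduct_mulVec]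
  simp [Matrix.IsHermitian, Matrix.IsSymm, Matrix.conjTranspose_eq_transpose_of_trivial]

namespace StateSpace

variable {n m : ℕ} (S : StateSpace n m)

/-- The extended state at time `k` along a trajectory, for `k ≥ l`. -/
noncomputable def extAt (l : ℕ) (z : (Fin n → ℝ) × (ℕ → Fin m → ℝ)) (k : ℕ) : ExtIdx m l → ℝ :=
  extState l z.2 (fun i => S.outMap i z) k

theorem extAt_add (l j k : ℕ) (hk : l ≤ k) (z : (Fin n → ℝ) × (ℕ → Fin m → ℝ)) :
    S.extAt l z (j + k) = S.extAt l (S.stateMap j z, fun i => z.2 (j + i)) k := by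
  have h : ∀ i, j + k - l + i = j + (k - l + i) := fun i => by omega
  funext p
  rcases p with p | p
  · simp only [extAt, extState, Sum.elim_inl, h]
  · simp only [extAt, extState, Sum.elim_inr, h, outMap_add]

theorem extAt_congr {l k : ℕ} (hk : l ≤ k) {x : Fin n → ℝ} {u v : ℕ → Fin m → ℝ}
    (h : ∀ i < k, u i = v i) : S.extAt l (x, u) k = S.extAt l (x, v) k := by
  funext p
  rcases p with p | p
  · simp only [extAt, extState, Sum.elim_inl]
    rw [h _ (by omega)]
  · simp only [extAt, extState, Sum.elim_inr]
    rw [S.outMap_congr fun i hi => h i (by omega)]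

variable {S}

/-- In an observable system the state is a linear function of the extended state. -/
theorem exists_stateMap_eq_extAt {l : ℕ}
    (hobs : ∀ x : Fin n → ℝ, (∀ s < l, (S.C * S.A ^ s) *ᵥ x = 0) → x = 0) :
    ∃ M : Matrix (Fin n) (ExtIdx m l) ℝ, ∀ z, ∀ k ≥ l, M *ᵥ S.extAt l z k = S.stateMap k z := by
  let f : ((Fin n → ℝ) × (ℕ → Fin m → ℝ)) →ₗ[ℝ] (ExtIdx m l → ℝ) :=
    { toFun := fun z => S.extAt l z l
      map_add' := fun z z' => by
        funext p
        rcases p with p | p <;> simp [extAt, extState]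
      map_smul' := fun c z => by
        funext p
        rcases p with p | p <;> simp [extAt, extState] }
  -- If inputs and outputs vanish on `[0, l)`, observability gives `x = 0`, hence the state at time
  -- `l` is zero and factors through the extended state.
  obtain ⟨M, hM⟩ := LinearMap.exists_comp_eq_of_ker_le (f := f) (g := S.stateMap l) (by
    rintro ⟨x, u⟩ hz
    have hu : ∀ i < l, u i = (0 : ℕ → Fin m → ℝ) i := fun i hi => by
      funext a
      simpa [f, extAt, extState] using congrFun hz (Sum.inl (⟨i, hi⟩, a))
    have hx : x = 0 := hobs x fun s hs => by
      have : S.outMap s (x, 0) = 0 := by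
        rw [← S.outMap_congr fun i hi => hu i (by omega)]
        funext a
        simpa [f, extAt, extState] using congrFun hz (Sum.inr (⟨s, hs⟩, a))
      rw [outMap_apply, stateMap_zero_input, Matrix.mulVec_mulVec] at this
      simpa using this
    rw [S.stateMap_congr hu, hx]
    exact map_zero (S.stateMap l))
  refine ⟨LinearMap.toMatrix' M, fun z k hk => ?_⟩
  obtain ⟨j, rfl⟩ := Nat.exists_eq_add_of_le' hk
  rw [LinearMap.toMatrix'_mulVec, extAt_add _ _ _ _ le_rfl, stateMap_add]
  exact hM _

theorem tendsto_extAt {l : ℕ} {z : (Fin n → ℝ) × (ℕ → Fin m → ℝ)}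
    (hu : Tendsto z.2 atTop (𝓝 0)) (hy : Tendsto (fun k => S.outMap k z) atTop (𝓝 0)) :
    Tendsto (S.extAt l z) atTop (𝓝 0) := by
  rw [tendsto_pi_nhds] at hu hy ⊢
  have h : ∀ i, Tendsto (fun k : ℕ => k - l + i) atTop atTop := fun i =>
    tendsto_atTop_mono (fun k => Nat.le_add_right _ _) (tendsto_sub_atTop_nat l)
  rintro (p | p)
  · exact (hu p.2).comp (h p.1)
  · exact (hy p.2).comp (h p.1)

theorem IsStorage.add_totalSupply_le {a b : ℝ} {Q : Matrix (Fin n) (Fin n) ℝ}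
    (hQ : S.IsStorage a b Q) (x : Fin n → ℝ) (u : ℕ → Fin m → ℝ) (T : ℕ) :
    S.stateMap T (x, u) ⬝ᵥ Q *ᵥ S.stateMap T (x, u) + S.totalSupply a b T x u
      ≤ x ⬝ᵥ Q *ᵥ x := by
  induction T with
  | zero => simp [totalSupply]
  | succ T ih =>
    have := hQ (S.stateMap T (x, u)) (u T)
    rw [totalSupply, Finset.sum_range_succ, stateMap_succ, outMap_apply]
    rw [totalSupply] at ih
    linarith

/-- A storage function is nonnegative at a state from which some trajectory has a strictly
positive supply, provided no trajectory from zero has positive total supply. -/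
theorem IsStorage.nonneg_of_supply {a b : ℝ} {Q : Matrix (Fin n) (Fin n) ℝ}
    (hQ : S.IsStorage a b Q) {l T₀ : ℕ} (hT₀ : S.reachAt T₀ = ⊤)
    (hobs : ∀ x : Fin n → ℝ, (∀ s < l, (S.C * S.A ^ s) *ᵥ x = 0) → x = 0)
    (htot : ∀ u T, S.totalSupply a b T 0 u ≤ 0) {x : Fin n → ℝ} {u : ℕ → Fin m → ℝ} {c : ℝ}
    (hc : 0 < c) (hsupp : ∀ k, c * (u k ⬝ᵥ u k + S.outMap k (x, u) ⬝ᵥ S.outMap k (x, u))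
      ≤ supply a b (u k) (S.outMap k (x, u))) : 0 ≤ x ⬝ᵥ Q *ᵥ x := by
  obtain ⟨v, hv⟩ := S.mem_reachAt.mp (hT₀ ▸ Submodule.mem_top : x ∈ S.reachAt T₀)
  set s : ℕ → ℝ := fun k => u k ⬝ᵥ u k + S.outMap k (x, u) ⬝ᵥ S.outMap k (x, u) with hs
  have hs0 : ∀ k, 0 ≤ s k := fun k =>
    add_nonneg (dotProduct_self_nonneg_real _) (dotProduct_self_nonneg_real _)
  have hle : ∀ T, c * ∑ k ∈ Finset.range T, s k ≤ S.totalSupply a b T x u := fun T => by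
    rw [Finset.mul_sum]
    exact Finset.sum_le_sum fun k _ => hsupp k
  have hsum : Summable s := by
    refine summable_of_sum_range_le (c := -S.totalSupply a b T₀ 0 v / c) hs0 fun T => ?_
    rw [le_div_iff₀ hc, mul_comm]
    -- Prefixing an input `v` that reaches `x` from zero bounds the supply from `x` uniformly in
    -- `T`.
    have := htot (seqAppend T₀ v u) (T₀ + T)
    rw [totalSupply_append, hv] at this
    linarith [hle T]
  have hs_lim := hsum.tendsto_atTop_zero
  have hu : Tendsto u atTop (𝓝 0) := tendsto_zero_of_dotProduct_self
    (squeeze_zero (fun k => dotProduct_self_nonneg_real _)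
      (fun k => le_add_of_nonneg_right (dotProduct_self_nonneg_real _)) hs_lim)
  have hy : Tendsto (fun k => S.outMap k (x, u)) atTop (𝓝 0) := tendsto_zero_of_dotProduct_self
    (squeeze_zero (fun k => dotProduct_self_nonneg_real _)
      (fun k => le_add_of_nonneg_left (dotProduct_self_nonneg_real _)) hs_lim)
  obtain ⟨M, hM⟩ := exists_stateMap_eq_extAt hobs
  have hstate : Tendsto (fun k => S.stateMap k (x, u)) atTop (𝓝 0) := by
    have hcont : Continuous fun w : ExtIdx m l → ℝ => M *ᵥ w := by fun_prop
    have h1 := (hcont.tendsto 0).comp (tendsto_extAt (l := l) (z := (x, u)) hu hy)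
    rw [Matrix.mulVec_zero] at h1
    refine h1.congr' ?_
    filter_upwards [eventually_ge_atTop l] with k hk
    exact hM _ k hk
  -- The stored quantity at time `T` tends to zero and never exceeds `xᵀ Q x`, since the supply is
  -- nonnegative.
  refine le_of_tendsto (Q.tendsto_dotProduct_mulVec_zero hstate) (Eventually.of_forall fun T => ?_)
  have h1 := hQ.add_totalSupply_le x u T
  have h2 := hle T
  have h3 : 0 ≤ c * ∑ k ∈ Finset.range T, s k :=
    mul_nonneg hc.le (Finset.sum_nonneg fun k _ => hs0 k)
  linarith

end StateSpace

/-! ### The LMIs as dissipation inequalities for data and for all trajectories. -/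

/-- The data matrices satisfy the dissipation inequality, tested on vectors. -/
def DataDissipative {m : ℕ} (N l : ℕ) (u y : ℕ → Fin m → ℝ)
    (P : Matrix (ExtIdx m l) (ExtIdx m l) ℝ) (a b : ℝ) : Prop :=
  ∀ g : Fin (N - l) → ℝ,
    (dataXiPlus N l u y *ᵥ g) ⬝ᵥ P *ᵥ (dataXiPlus N l u y *ᵥ g)
      - (dataXi N l u y *ᵥ g) ⬝ᵥ P *ᵥ (dataXi N l u y *ᵥ g)
      + supply a b (dataSignal N l u *ᵥ g) (dataSignal N l y *ᵥ g) ≤ 0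

theorem Matrix.dotProduct_transpose_mul_mul {ι κ : Type*} [Fintype ι] [Fintype κ]
    (X : Matrix ι κ ℝ) (P : Matrix ι ι ℝ) (g : κ → ℝ) :
    g ⬝ᵥ (Xᵀ * P * X) *ᵥ g = (X *ᵥ g) ⬝ᵥ P *ᵥ (X *ᵥ g) := by
  rw [← Matrix.mulVec_mulVec, ← Matrix.mulVec_mulVec, Matrix.dotProduct_mulVec,
    Matrix.vecMul_transpose]

theorem Matrix.dotProduct_transpose_mul_self {ι κ : Type*} [Fintype ι] [Fintype κ]
    (X : Matrix ι κ ℝ) (g : κ → ℝ) : g ⬝ᵥ (Xᵀ * X) *ᵥ g = (X *ᵥ g) ⬝ᵥ (X *ᵥ g) := by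
  rw [← Matrix.mulVec_mulVec, Matrix.dotProduct_mulVec, Matrix.vecMul_transpose]

theorem maxGainLMI_iff {m N l : ℕ} {u y : ℕ → Fin m → ℝ}
    {P : Matrix (ExtIdx m l) (ExtIdx m l) ℝ} (hP : P.IsSymm) {γ : ℝ} :
    MaxGainLMI N l u y P γ ↔ DataDissipative N l u y P 1 (-γ ^ 2) := by
  have hP' : Pᵀ = P := hP
  rw [MaxGainLMI, Matrix.posSemidef_iff_isSymm, and_iff_right, DataDissipative]
  · refine forall_congr' fun g => ?_
    simp only [Matrix.neg_mulVec, Matrix.sub_mulVec, Matrix.add_mulVec, Matrix.smul_mulVec,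
      dotProduct_neg, dotProduct_sub, dotProduct_add, dotProduct_smul,
      Matrix.dotProduct_transpose_mul_mul, Matrix.dotProduct_transpose_mul_self, supply, smul_eq_mul]
    constructor <;> intro h <;> linarith
  · simp [Matrix.IsSymm, Matrix.transpose_mul, hP', Matrix.mul_assoc]

theorem minGainLMI_iff {m N l : ℕ} {u y : ℕ → Fin m → ℝ}
    {P : Matrix (ExtIdx m l) (ExtIdx m l) ℝ} (hP : P.IsSymm) {ζ : ℝ} :
    MinGainLMI N l u y P ζ ↔ DataDissipative N l u y P (-1) (ζ ^ 2) := by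
  have hP' : Pᵀ = P := hP
  rw [MinGainLMI, Matrix.posSemidef_iff_isSymm, and_iff_right, DataDissipative]
  · refine forall_congr' fun g => ?_
    simp only [Matrix.neg_mulVec, Matrix.sub_mulVec, Matrix.add_mulVec, Matrix.smul_mulVec,
      dotProduct_neg, dotProduct_sub, dotProduct_add, dotProduct_smul,
      Matrix.dotProduct_transpose_mul_mul, Matrix.dotProduct_transpose_mul_self, supply, smul_eq_mul]
    constructor <;> intro h <;> linarith
  · simp [Matrix.IsSymm, Matrix.transpose_mul, hP', Matrix.mul_assoc]

namespace StateSpace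

variable {n m : ℕ} {S : StateSpace n m}

/-- A linear combination of data windows is a trajectory. -/
theorem data_mulVec {N l : ℕ} {x : ℕ → Fin n → ℝ} {u y : ℕ → Fin m → ℝ}
    (hx : ∀ k < N, x (k + 1) = S.A *ᵥ x k + S.B *ᵥ u k ∧ y k = S.C *ᵥ x k + S.D *ᵥ u k)
    (g : Fin (N - l) → ℝ) {z : (Fin n → ℝ) × (ℕ → Fin m → ℝ)}
    (hz₁ : ∑ j, g j • x j = z.1) (hz₂ : ∀ i < l + 1, ∑ j, g j • u (j + i) = z.2 i) :
    dataXi N l u y *ᵥ g = S.extAt l z l ∧ dataXiPlus N l u y *ᵥ g = S.extAt l z (l + 1) ∧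
      dataSignal N l u *ᵥ g = z.2 l ∧ dataSignal N l y *ᵥ g = S.outMap l z := by
  have hstate : ∀ i ≤ l, ∑ j, g j • x (j + i) = S.stateMap i z := by
    intro i
    induction i with
    | zero => intro _; exact hz₁
    | succ i ih =>
      intro hi
      rw [stateMap_succ, ← ih (by omega), ← hz₂ i (by omega), Matrix.mulVec_sum, Matrix.mulVec_sum,
        ← Finset.sum_add_distrib]
      refine Finset.sum_congr rfl fun j _ => ?_
      rw [← add_assoc, (hx (j + i) (by omega)).1, smul_add, Matrix.mulVec_smul, Matrix.mulVec_smul]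
  have hout : ∀ i ≤ l, ∑ j, g j • y (j + i) = S.outMap i z := by
    intro i hi
    rw [outMap_apply, ← hstate i hi, ← hz₂ i (by omega), Matrix.mulVec_sum, Matrix.mulVec_sum,
      ← Finset.sum_add_distrib]
    refine Finset.sum_congr rfl fun j _ => ?_
    rw [(hx (j + i) (by omega)).2, smul_add, Matrix.mulVec_smul, Matrix.mulVec_smul]
  -- `c j` is the time index as the data matrices spell it, `j + i` its position `i` in the window
  -- starting at `j`.
  have key : ∀ (w : ℕ → Fin m → ℝ) (v : Fin m → ℝ) (i : ℕ) (c : Fin (N - l) → ℕ) (a : Fin m),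
      (∀ j, c j = j + i) → ∑ j, g j • w (j + i) = v → ∑ j, w (c j) a * g j = v a := by
    intro w v i c a hc hv
    rw [← hv, Finset.sum_apply]
    exact Finset.sum_congr rfl fun j _ => by rw [hc, Pi.smul_apply, smul_eq_mul, mul_comm]
  refine ⟨?_, ?_, ?_, ?_⟩
  · funext p
    rcases p with p | p
    · exact key u _ (l - l + p.1) _ _ (fun j => by omega) (hz₂ _ (by omega))
    · exact key y _ (l - l + p.1) _ _ (fun j => by omega) (hout _ (by omega))
  · funext p
    rcases p with p | p
    · exact key u _ (l + 1 - l + p.1) _ _ (fun j => by omega) (hz₂ _ (by omega))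
    · exact key y _ (l + 1 - l + p.1) _ _ (fun j => by omega) (hout _ (by omega))
  · funext a
    exact key u _ l _ _ (fun j => by omega) (hz₂ l (by omega))
  · funext a
    exact key y _ l _ _ (fun j => by omega) (hout l le_rfl)

theorem IsStorage.dataDissipative {N l : ℕ} {u y : ℕ → Fin m → ℝ} (hdata : S.IsTrajectory N u y)
    {a b : ℝ} {Q : Matrix (Fin n) (Fin n) ℝ} (hQ : S.IsStorage a b Q)
    {M : Matrix (Fin n) (ExtIdx m l) ℝ}
    (hM : ∀ z, ∀ k ≥ l, M *ᵥ S.extAt l z k = S.stateMap k z) :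
    DataDissipative N l u y (Mᵀ * Q * M) a b := by
  obtain ⟨x, hx⟩ := hdata
  intro g
  obtain ⟨h1, h2, h3, h4⟩ := data_mulVec hx g
    (z := (∑ j, g j • x j, fun i => ∑ j, g j • u (j + i))) rfl (fun _ _ => rfl)
  rw [h1, h2, h3, h4, Matrix.dotProduct_transpose_mul_mul, Matrix.dotProduct_transpose_mul_mul,
    hM _ _ le_rfl, hM _ _ (Nat.le_succ l), stateMap_succ, outMap_apply]
  exact hQ _ _

/-- Under persistency of excitation, dissipativity of the data extends to all trajectories. -/
theorem _root_.DataDissipative.extAt_le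
    (hS : ∀ ξ : Fin n → ℝ, (∀ s, ξ ᵥ* (S.A ^ s * S.B) = 0) → ξ = 0) {N l : ℕ}
    {u y : ℕ → Fin m → ℝ} (hdata : S.IsTrajectory N u y)
    (hu : PersistentlyExciting N u (n + l + 1)) {P : Matrix (ExtIdx m l) (ExtIdx m l) ℝ} {a b : ℝ}
    (hP : DataDissipative N l u y P a b) (z : (Fin n → ℝ) × (ℕ → Fin m → ℝ)) (j : ℕ) :
    S.extAt l z (j + (l + 1)) ⬝ᵥ P *ᵥ S.extAt l z (j + (l + 1))
      - S.extAt l z (j + l) ⬝ᵥ P *ᵥ S.extAt l z (j + l)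
      + supply a b (z.2 (j + l)) (S.outMap (j + l) z) ≤ 0 := by
  obtain ⟨x, hx⟩ := hdata
  obtain ⟨g, hg₁, hg₂⟩ := S.exists_window_combination hS hu (fun k hk => (hx k hk).1)
    (S.stateMap j z) (fun i => z.2 (j + i))
  obtain ⟨h1, h2, h3, h4⟩ := data_mulVec hx g
    (z := (S.stateMap j z, fun i => z.2 (j + i))) hg₁ hg₂
  have := hP g
  rw [h1, h2, h3, h4] at this
  rwa [extAt_add _ _ _ _ le_rfl, extAt_add _ _ _ _ (Nat.le_succ l), outMap_add]

/-- The one-step inequality telescopes. Extended states need `l` past samples, so `l` zero inputs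
are put in front: they leave the state at zero and make the initial extended state vanish. -/
theorem _root_.DataDissipative.add_totalSupply_le
    (hS : ∀ ξ : Fin n → ℝ, (∀ s, ξ ᵥ* (S.A ^ s * S.B) = 0) → ξ = 0) {N l : ℕ}
    {u y : ℕ → Fin m → ℝ} (hdata : S.IsTrajectory N u y)
    (hu : PersistentlyExciting N u (n + l + 1)) {P : Matrix (ExtIdx m l) (ExtIdx m l) ℝ} {a b : ℝ}
    (hP : DataDissipative N l u y P a b) (v : ℕ → Fin m → ℝ) (T : ℕ) :
    S.extAt l (0, seqAppend l 0 v) (T + l) ⬝ᵥ P *ᵥ S.extAt l (0, seqAppend l 0 v) (T + l)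
      + S.totalSupply a b T 0 v ≤ 0 := by
  have h0 : S.stateMap l ((0 : Fin n → ℝ), (0 : ℕ → Fin m → ℝ)) = 0 := map_zero (S.stateMap l)
  induction T with
  | zero =>
    have : S.extAt l ((0 : Fin n → ℝ), seqAppend l 0 v) (0 + l) = 0 := by
      rw [zero_add, S.extAt_congr le_rfl (v := 0) fun i hi => seqAppend_of_lt hi]
      funext p
      rcases p with p | p
      · rfl
      · exact congrFun (map_zero (S.outMap (l - l + p.1))) p.2
    rw [this]
    simp [totalSupply]
  | succ T ih =>
    have h1 := hP.extAt_le hS hdata hu (0, seqAppend l 0 v) T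
    have h2 : S.outMap (T + l) (0, seqAppend l 0 v) = S.outMap T (0, v) := by
      rw [add_comm, outMap_append_add, h0]
    have h3 : seqAppend l 0 v (T + l) = v T := by rw [add_comm, seqAppend_add]
    rw [h2] at h1
    simp only [h3] at h1
    rw [totalSupply, Finset.sum_range_succ, add_right_comm T 1 l, add_assoc T l 1]
    rw [totalSupply] at ih
    linarith

end StateSpace

/-! ### Gains as norm inequalities. -/

section Gains

variable {E F : Type*} [NormedAddCommGroup E] [NormedSpace ℂ E]
  [NormedAddCommGroup F] [NormedSpace ℂ F]

theorem maxGain_le_iff {T : E →ₗ.[ℂ] F} {γ : ℝ≥0} :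
    maxGain T ≤ γ ↔ ∀ u : T.domain, ‖T u‖ ≤ γ * ‖(u : E)‖ := by
  rw [maxGain, iSup₂_le_iff]
  refine forall_congr' fun u => ?_
  rcases eq_or_ne u 0 with rfl | hu
  · simp
  · have h0 : ‖(u : E)‖ₑ ≠ 0 := by simpa using hu
    rw [ENNReal.div_le_iff h0 enorm_ne_top]
    simp only [hu, ne_eq, not_false_eq_true, forall_const]
    rw [← enorm_norm (T u), ← enorm_norm (u : E), Real.enorm_of_nonneg (norm_nonneg _),
      Real.enorm_of_nonneg (norm_nonneg _), ← ENNReal.ofReal_coe_nnreal,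
      ← ENNReal.ofReal_mul γ.coe_nonneg, ENNReal.ofReal_le_ofReal_iff (by positivity)]

theorem le_minGain_iff {T : E →ₗ.[ℂ] F} {ζ : ℝ≥0} :
    (ζ : ℝ≥0∞) ≤ minGain T ↔ ∀ u : T.domain, ζ * ‖(u : E)‖ ≤ ‖T u‖ := by
  rw [minGain, le_iInf₂_iff]
  refine forall_congr' fun u => ?_
  rcases eq_or_ne u 0 with rfl | hu
  · simp
  · have h0 : ‖(u : E)‖ₑ ≠ 0 := by simpa using hu
    rw [ENNReal.le_div_iff_mul_le (Or.inl h0) (Or.inl enorm_ne_top)]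
    simp only [hu, ne_eq, not_false_eq_true, forall_const]
    rw [← enorm_norm (T u), ← enorm_norm (u : E), Real.enorm_of_nonneg (norm_nonneg _),
      Real.enorm_of_nonneg (norm_nonneg _), ← ENNReal.ofReal_coe_nnreal,
      ← ENNReal.ofReal_mul ζ.coe_nonneg, ENNReal.ofReal_le_ofReal_iff (by positivity)]

end Gains

/-! ### Complex signals through their real and imaginary parts. -/

section Complex

variable {m : ℕ}

/-- Real parts of a complex sequence. -/
def reSeq (u : ℕ → EuclideanSpace ℂ (Fin m)) : ℕ → Fin m → ℝ := fun k a => (u k a).re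

/-- Imaginary parts of a complex sequence. -/
def imSeq (u : ℕ → EuclideanSpace ℂ (Fin m)) : ℕ → Fin m → ℝ := fun k a => (u k a).im

/-- A real sequence as a complex sequence. -/
noncomputable def ofRealSeq (v : ℕ → Fin m → ℝ) : ℕ → EuclideanSpace ℂ (Fin m) :=
  fun k => WithLp.toLp 2 fun a => (v k a : ℂ)

theorem norm_sq_eq_reSeq_add_imSeq (u : ℕ → EuclideanSpace ℂ (Fin m)) (k : ℕ) :
    ‖u k‖ ^ 2 = reSeq u k ⬝ᵥ reSeq u k + imSeq u k ⬝ᵥ imSeq u k := by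
  rw [EuclideanSpace.norm_sq_eq, dotProduct, dotProduct, ← Finset.sum_add_distrib]
  refine Finset.sum_congr rfl fun a _ => ?_
  rw [← Complex.normSq_eq_norm_sq, Complex.normSq_apply]
  rfl

theorem complexAct_re (M : Matrix (Fin m) (Fin m) ℝ) (v : EuclideanSpace ℂ (Fin m)) (a : Fin m) :
    (complexAct M v a).re = (M *ᵥ fun b => (v b).re) a := by
  change ((M.map (algebraMap ℝ ℂ) *ᵥ v.ofLp) a).re = _
  simp [Matrix.mulVec, dotProduct]

theorem complexAct_im (M : Matrix (Fin m) (Fin m) ℝ) (v : EuclideanSpace ℂ (Fin m)) (a : Fin m) :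
    (complexAct M v a).im = (M *ᵥ fun b => (v b).im) a := by
  change ((M.map (algebraMap ℝ ℂ) *ᵥ v.ofLp) a).im = _
  simp [Matrix.mulVec, dotProduct]

namespace StateSpace

variable {n : ℕ} (S : StateSpace n m)

theorem response_apply (u : ℕ → EuclideanSpace ℂ (Fin m)) (j : ℕ) :
    S.response u j = (∑ i ∈ Finset.range j, complexAct (S.C * S.A ^ (j - 1 - i) * S.B) (u i))
      + complexAct S.D (u j) := rfl

theorem reSeq_response (u : ℕ → EuclideanSpace ℂ (Fin m)) (j : ℕ) :
    reSeq (S.response u) j = S.outMap j (0, reSeq u) := by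
  funext a
  rw [outMap_eq_sum]
  simp only [reSeq, response_apply, PiLp.add_apply, WithLp.ofLp_sum, Finset.sum_apply,
    Complex.add_re, Complex.re_sum, complexAct_re, Pi.add_apply]
  rfl

theorem imSeq_response (u : ℕ → EuclideanSpace ℂ (Fin m)) (j : ℕ) :
    imSeq (S.response u) j = S.outMap j (0, imSeq u) := by
  funext a
  rw [outMap_eq_sum]
  simp only [imSeq, response_apply, PiLp.add_apply, WithLp.ofLp_sum, Finset.sum_apply,
    Complex.add_im, Complex.im_sum, complexAct_im, Pi.add_apply]
  rfl

/-- The total supply of the real and imaginary parts of a complex trajectory. -/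
theorem totalSupply_re_add_im (a b : ℝ) (T : ℕ) (u : ℕ → EuclideanSpace ℂ (Fin m)) :
    S.totalSupply a b T 0 (reSeq u) + S.totalSupply a b T 0 (imSeq u)
      = a * ∑ k ∈ Finset.range T, ‖S.response u k‖ ^ 2
        + b * ∑ k ∈ Finset.range T, ‖u k‖ ^ 2 := by
  simp only [totalSupply, Finset.mul_sum, ← Finset.sum_add_distrib]
  refine Finset.sum_congr rfl fun k _ => ?_
  rw [norm_sq_eq_reSeq_add_imSeq, norm_sq_eq_reSeq_add_imSeq, reSeq_response, imSeq_response,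
    supply, supply]
  ring

theorem totalSupply_zero (a b : ℝ) (T : ℕ) :
    S.totalSupply a b T (0 : Fin n → ℝ) (0 : ℕ → Fin m → ℝ) = 0 := by
  refine Finset.sum_eq_zero fun k _ => ?_
  rw [show S.outMap k ((0 : Fin n → ℝ), (0 : ℕ → Fin m → ℝ)) = 0 from map_zero (S.outMap k)]
  simp [supply]

theorem totalSupply_congr {a b : ℝ} {T : ℕ} {x : Fin n → ℝ} {u v : ℕ → Fin m → ℝ}
    (h : ∀ k < T, u k = v k) : S.totalSupply a b T x u = S.totalSupply a b T x v := by
  refine Finset.sum_congr rfl fun k hk => ?_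
  have hk := Finset.mem_range.mp hk
  rw [h k hk, S.outMap_congr fun i hi => h i (by omega)]

end StateSpace

theorem ELL2.hasSum_norm_sq (f : ELL2 m) : HasSum (fun k => ‖f k‖ ^ 2) (‖f‖ ^ 2) := by
  have := lp.hasSum_norm (p := 2) (by norm_num) f
  simpa using this

theorem ELL2.norm_sq_eq_sum {T : ℕ} {f : ELL2 m} (h : ∀ k, T ≤ k → f k = 0) :
    ‖f‖ ^ 2 = ∑ k ∈ Finset.range T, ‖f k‖ ^ 2 :=
  (ELL2.hasSum_norm_sq f).unique (hasSum_sum_of_ne_finset_zero fun k hk => by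
    rw [h k (by simpa using hk)]; simp)

/-- A sequence that vanishes from time `T` on, as an element of `ℓ₂`. -/
noncomputable def ELL2.ofFinite (T : ℕ) (f : ℕ → EuclideanSpace ℂ (Fin m)) : ELL2 m :=
  ⟨fun k => if k < T then f k else 0, by
    have h0 : Memℓp (fun k => if k < T then f k else 0) 0 := by
      refine memℓp_zero ((Set.finite_lt_nat T).subset fun k hk => ?_)
      by_contra hk'
      exact hk (if_neg hk')
    exact h0.of_exponent_ge (by simp)⟩

theorem ELL2.ofFinite_apply (T : ℕ) (f : ℕ → EuclideanSpace ℂ (Fin m)) (k : ℕ) :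
    ELL2.ofFinite T f k = if k < T then f k else 0 := rfl

theorem ELL2.tendsto_zero (f : ELL2 m) : Tendsto (fun k => ‖f k‖ ^ 2) atTop (𝓝 0) :=
  (ELL2.hasSum_norm_sq f).summable.tendsto_atTop_zero

theorem tendsto_reSeq {f : ℕ → EuclideanSpace ℂ (Fin m)}
    (h : Tendsto (fun k => ‖f k‖ ^ 2) atTop (𝓝 0)) : Tendsto (reSeq f) atTop (𝓝 0) :=
  tendsto_zero_of_dotProduct_self (squeeze_zero (fun _ => dotProduct_self_nonneg_real _)
    (fun k => by
      rw [norm_sq_eq_reSeq_add_imSeq]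
      exact le_add_of_nonneg_right (dotProduct_self_nonneg_real _)) h)

theorem tendsto_imSeq {f : ℕ → EuclideanSpace ℂ (Fin m)}
    (h : Tendsto (fun k => ‖f k‖ ^ 2) atTop (𝓝 0)) : Tendsto (imSeq f) atTop (𝓝 0) :=
  tendsto_zero_of_dotProduct_self (squeeze_zero (fun _ => dotProduct_self_nonneg_real _)
    (fun k => by
      rw [norm_sq_eq_reSeq_add_imSeq]
      exact le_add_of_nonneg_left (dotProduct_self_nonneg_real _)) h)

end Complex

theorem sq_le_mul_sq_iff {x y : ℝ} {c : ℝ} (hx : 0 ≤ x) (hy : 0 ≤ y) (hc : 0 ≤ c) :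
    x ≤ c * y ↔ x ^ 2 ≤ c ^ 2 * y ^ 2 := by
  rw [← mul_pow, sq_le_sq₀ hx (mul_nonneg hc hy)]

/-! ### Gains of the two operators in terms of total supplies. -/

namespace StateSpace

variable {n m : ℕ} (S : StateSpace n m)

/-- A quadratic inequality between the norms of inputs and outputs of the truncated operator
holds if and only if no real input has positive total supply. -/
theorem forall_truncOp_iff (a b : ℝ) (τ : ℕ) :
    (∀ u : (S.truncOp τ).domain, a * ‖S.truncOp τ u‖ ^ 2 + b * ‖(u : ell2Trunc m τ)‖ ^ 2 ≤ 0) ↔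
      ∀ v, S.totalSupply a b τ 0 v ≤ 0 := by
  have key : ∀ u : (S.truncOp τ).domain,
      a * ‖S.truncOp τ u‖ ^ 2 + b * ‖(u : ell2Trunc m τ)‖ ^ 2
        = S.totalSupply a b τ 0 (reSeq ((u : ell2Trunc m τ) : ELL2 m))
          + S.totalSupply a b τ 0 (imSeq ((u : ell2Trunc m τ) : ELL2 m)) := by
    intro u
    have h1 : ‖(u : ell2Trunc m τ)‖ ^ 2
        = ∑ k ∈ Finset.range τ, ‖((u : ell2Trunc m τ) : ELL2 m) k‖ ^ 2 :=
      ELL2.norm_sq_eq_sum (u : ell2Trunc m τ).2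
    have h2 : ‖S.truncOp τ u‖ ^ 2
        = ∑ k ∈ Finset.range τ, ‖S.response ((u : ell2Trunc m τ) : ELL2 m) k‖ ^ 2 := by
      refine (ELL2.norm_sq_eq_sum (S.truncOp τ u).2).trans (Finset.sum_congr rfl fun k hk => ?_)
      change ‖S.truncResponse τ _ k‖ ^ 2 = _
      rw [truncResponse, if_pos (Finset.mem_range.mp hk)]
      rfl
    rw [totalSupply_re_add_im, h1, h2]
  constructor
  · intro h v
    have h1 := h ⟨⟨ELL2.ofFinite τ (ofRealSeq v), fun k hk => if_neg (not_lt.mpr hk)⟩, trivial⟩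
    rw [key] at h1
    have h2 : S.totalSupply a b τ 0 (reSeq (ELL2.ofFinite τ (ofRealSeq v)))
        = S.totalSupply a b τ 0 v := S.totalSupply_congr fun k hk => by
      funext i
      simp [reSeq, ELL2.ofFinite_apply, hk, ofRealSeq]
    have h3 : S.totalSupply a b τ 0 (imSeq (ELL2.ofFinite τ (ofRealSeq v))) = 0 := by
      rw [← S.totalSupply_zero a b τ]
      refine S.totalSupply_congr fun k hk => ?_
      funext i
      simp [imSeq, ELL2.ofFinite_apply, hk, ofRealSeq]
    simp only at h1
    rw [h2, h3] at h1
    linarith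
  · intro h u
    rw [key]
    exact add_nonpos (h _) (h _)

theorem maxGain_truncOp_le_iff {τ : ℕ} {γ : ℝ≥0} :
    maxGain (S.truncOp τ) ≤ γ ↔ ∀ v, S.totalSupply 1 (-(γ : ℝ) ^ 2) τ 0 v ≤ 0 := by
  rw [maxGain_le_iff, ← forall_truncOp_iff]
  refine forall_congr' fun u => ?_
  rw [sq_le_mul_sq_iff (norm_nonneg _) (norm_nonneg _) γ.coe_nonneg]
  constructor <;> intro h <;> linarith

theorem le_minGain_truncOp_iff {τ : ℕ} {ζ : ℝ≥0} :
    (ζ : ℝ≥0∞) ≤ minGain (S.truncOp τ) ↔ ∀ v, S.totalSupply (-1) ((ζ : ℝ) ^ 2) τ 0 v ≤ 0 := by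
  rw [le_minGain_iff, ← forall_truncOp_iff]
  refine forall_congr' fun u => ?_
  rw [← sq_le_sq₀ (by positivity) (norm_nonneg _), mul_pow]
  constructor <;> intro h <;> linarith

/-- If a quadratic inequality between the norms of inputs and outputs of the full operator holds,
then cycles through the zero state have no positive total supply. -/
theorem totalSupply_le_of_forall_op {a b : ℝ}
    (h : ∀ u : S.op.domain, a * ‖S.op u‖ ^ 2 + b * ‖(u : ELL2 m)‖ ^ 2 ≤ 0)
    {v : ℕ → Fin m → ℝ} {T : ℕ} (hv : S.stateMap T (0, v) = 0) :
    S.totalSupply a b T 0 v ≤ 0 := by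
  set f : ELL2 m := ELL2.ofFinite T (ofRealSeq v) with hf
  have hre : reSeq f = seqAppend T v 0 := by
    funext k i
    by_cases hk : k < T <;> simp [reSeq, hf, ELL2.ofFinite_apply, hk, ofRealSeq, seqAppend]
  have him : imSeq f = 0 := by
    funext k i
    by_cases hk : k < T <;> simp [imSeq, hf, ELL2.ofFinite_apply, hk, ofRealSeq]
  -- Input and state are zero from time `T` on, so the output has finite support and `f` lies in the
  -- domain of `T`.
  have hy : ∀ k, T ≤ k → S.response f k = 0 := by
    intro k hk
    obtain ⟨j, rfl⟩ := Nat.exists_eq_add_of_le hk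
    have h1 := norm_sq_eq_reSeq_add_imSeq (S.response f) (T + j)
    rw [reSeq_response, imSeq_response, hre, him, outMap_append_add, hv,
      show S.outMap j ((0 : Fin n → ℝ), (0 : ℕ → Fin m → ℝ)) = 0 from map_zero (S.outMap j),
      show S.outMap (T + j) ((0 : Fin n → ℝ), (0 : ℕ → Fin m → ℝ)) = 0 from
        map_zero (S.outMap (T + j))] at h1
    simpa using h1
  have hmem : Memℓp (S.response f) 2 := by
    have h0 : Memℓp (S.response f) 0 := by
      refine memℓp_zero ((Set.finite_lt_nat T).subset fun k hk => ?_)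
      by_contra hk'
      exact hk (hy k (not_lt.mp hk'))
    exact h0.of_exponent_ge (by simp)
  have h1 := h ⟨f, hmem⟩
  have h2 : ‖S.op ⟨f, hmem⟩‖ ^ 2 = ∑ k ∈ Finset.range T, ‖S.response f k‖ ^ 2 :=
    ELL2.norm_sq_eq_sum hy
  have h3 : ‖f‖ ^ 2 = ∑ k ∈ Finset.range T, ‖f k‖ ^ 2 :=
    ELL2.norm_sq_eq_sum fun k hk => if_neg (not_lt.mpr hk)
  change _ + b * ‖f‖ ^ 2 ≤ 0 at h1
  rw [h2, h3, ← totalSupply_re_add_im, hre, him, totalSupply_zero, add_zero,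
    S.totalSupply_congr fun k hk => seqAppend_of_lt hk] at h1
  exact h1

variable {S}

/-- Dissipative data yield a quadratic inequality for the full operator. -/
theorem _root_.DataDissipative.forall_op
    (hS : ∀ ξ : Fin n → ℝ, (∀ s, ξ ᵥ* (S.A ^ s * S.B) = 0) → ξ = 0) {N l : ℕ}
    {u y : ℕ → Fin m → ℝ} (hdata : S.IsTrajectory N u y)
    (hu : PersistentlyExciting N u (n + l + 1)) {P : Matrix (ExtIdx m l) (ExtIdx m l) ℝ} {a b : ℝ}
    (hP : DataDissipative N l u y P a b) (f : S.op.domain) :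
    a * ‖S.op f‖ ^ 2 + b * ‖(f : ELL2 m)‖ ^ 2 ≤ 0 := by
  have hstore : ∀ v : ℕ → Fin m → ℝ, Tendsto v atTop (𝓝 0) →
      Tendsto (fun k => S.outMap k (0, v)) atTop (𝓝 0) →
      Tendsto (fun T => S.extAt l (0, seqAppend l 0 v) (T + l) ⬝ᵥ P *ᵥ
        S.extAt l (0, seqAppend l 0 v) (T + l)) atTop (𝓝 0) := by
    intro v hv hy
    have h0 : S.stateMap l ((0 : Fin n → ℝ), (0 : ℕ → Fin m → ℝ)) = 0 := map_zero (S.stateMap l)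
    -- Decay of input and output makes the extended state tend to zero, whatever the internal
    -- stability of the system; hence the sign of `P` does not matter.
    refine P.tendsto_dotProduct_mulVec_zero ((tendsto_add_atTop_iff_nat l).mpr (tendsto_extAt ?_ ?_))
    · refine (tendsto_add_atTop_iff_nat l).mp ?_
      simpa only [add_comm _ l, seqAppend_add] using hv
    · refine (tendsto_add_atTop_iff_nat l).mp ?_
      simpa only [add_comm _ l, outMap_append_add, h0] using hy
  have hu0 := ELL2.tendsto_zero (f : ELL2 m)
  have hy0 := ELL2.tendsto_zero (S.op f)
  have h1 := hstore _ (tendsto_reSeq hu0) (by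
    have := tendsto_reSeq hy0
    exact this.congr fun k => S.reSeq_response _ k)
  have h2 := hstore _ (tendsto_imSeq hu0) (by
    have := tendsto_imSeq hy0
    exact this.congr fun k => S.imSeq_response _ k)
  have hsum := ((ELL2.hasSum_norm_sq (S.op f)).tendsto_sum_nat.const_mul a).add
    ((ELL2.hasSum_norm_sq (f : ELL2 m)).tendsto_sum_nat.const_mul b)
  have hlim := (h1.add h2).add hsum
  rw [add_zero, zero_add] at hlim
  refine le_of_tendsto hlim (Eventually.of_forall fun T => ?_)
  have h3 := hP.add_totalSupply_le hS hdata hu (reSeq (f : ELL2 m)) T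
  have h4 := hP.add_totalSupply_le hS hdata hu (imSeq (f : ELL2 m)) T
  have h5 := S.totalSupply_re_add_im a b T (f : ELL2 m)
  change _ + (a * ∑ k ∈ Finset.range T, ‖S.response (f : ELL2 m) k‖ ^ 2 + _) ≤ 0
  linarith

theorem maxGain_op_le_iff {γ : ℝ≥0} : maxGain S.op ≤ γ ↔
    ∀ u : S.op.domain, 1 * ‖S.op u‖ ^ 2 + -(γ : ℝ) ^ 2 * ‖(u : ELL2 m)‖ ^ 2 ≤ 0 := by
  rw [maxGain_le_iff]
  refine forall_congr' fun u => ?_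
  rw [sq_le_mul_sq_iff (norm_nonneg _) (norm_nonneg _) γ.coe_nonneg]
  constructor <;> intro h <;> linarith

theorem le_minGain_op_iff {ζ : ℝ≥0} : (ζ : ℝ≥0∞) ≤ minGain S.op ↔
    ∀ u : S.op.domain, -1 * ‖S.op u‖ ^ 2 + (ζ : ℝ) ^ 2 * ‖(u : ELL2 m)‖ ^ 2 ≤ 0 := by
  rw [le_minGain_iff]
  refine forall_congr' fun u => ?_
  rw [← sq_le_sq₀ (by positivity) (norm_nonneg _), mul_pow]
  constructor <;> intro h <;> linarith

end StateSpace

/-! ### Feasibility of the LMIs and the gains. -/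

theorem ENNReal.iInf_nnreal_eq {p : ℝ≥0 → Prop} {x : ℝ≥0∞} (h : ∀ γ, p γ ↔ x ≤ γ) :
    ⨅ (γ : ℝ≥0) (_ : p γ), (γ : ℝ≥0∞) = x := by
  refine le_antisymm ?_ (le_iInf₂ fun γ hγ => (h γ).mp hγ)
  induction x using ENNReal.recTopCoe with
  | top => exact le_top
  | coe x => exact iInf₂_le x ((h x).mpr le_rfl)

theorem ENNReal.iSup_nnreal_eq {p : ℝ≥0 → Prop} {x : ℝ≥0∞} (h : ∀ ζ : ℝ≥0, p ζ ↔ (ζ : ℝ≥0∞) ≤ x) :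
    ⨆ (ζ : ℝ≥0) (_ : p ζ), (ζ : ℝ≥0∞) = x := by
  refine le_antisymm (iSup₂_le fun ζ hζ => (h ζ).mp hζ) ?_
  refine ENNReal.le_of_forall_nnreal_lt fun ζ hζ => ?_
  exact le_iSup₂_of_le ζ ((h ζ).mpr hζ.le) le_rfl

namespace StateSpace

variable {n m : ℕ} {S : StateSpace n m}

/-- Delaying the input by one step embeds horizon `T` into horizon `T + 1`; this makes the truncated
gains monotone in `τ`, so that their limits exist. -/
theorem totalSupply_delay (a b : ℝ) (T : ℕ) (v : ℕ → Fin m → ℝ) :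
    S.totalSupply a b (1 + T) 0 (seqAppend 1 0 v) = S.totalSupply a b T 0 v := by
  rw [totalSupply_append, totalSupply_zero, zero_add,
    show S.stateMap 1 ((0 : Fin n → ℝ), (0 : ℕ → Fin m → ℝ)) = 0 from map_zero (S.stateMap 1)]

variable (S) in
theorem monotone_maxGain_truncOp : Monotone fun τ => maxGain (S.truncOp τ) := by
  refine monotone_nat_of_le_succ fun τ => ?_
  generalize hx : maxGain (S.truncOp (τ + 1)) = x
  induction x using ENNReal.recTopCoe with
  | top => exact le_top
  | coe γ =>
    have h := S.maxGain_truncOp_le_iff.mp hx.le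
    refine S.maxGain_truncOp_le_iff.mpr fun v => ?_
    rw [← totalSupply_delay, add_comm]
    exact h _

variable (S) in
theorem antitone_minGain_truncOp : Antitone fun τ => minGain (S.truncOp τ) := by
  refine antitone_nat_of_succ_le fun τ => ENNReal.le_of_forall_nnreal_lt fun ζ hζ => ?_
  have h := S.le_minGain_truncOp_iff.mp hζ.le
  refine S.le_minGain_truncOp_iff.mpr fun v => ?_
  rw [← totalSupply_delay, add_comm]
  exact h _

variable {l N : ℕ} {u y : ℕ → Fin m → ℝ}

theorem MarkovMinimal.exists_isSymm_dataDissipative_iff (hS : S.MarkovMinimal) (hl : S.lag ≤ l)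
    (hdata : S.IsTrajectory N u y) (hu : PersistentlyExciting N u (n + l + 1)) {a b : ℝ} :
    (∃ P : Matrix (ExtIdx m l) (ExtIdx m l) ℝ, P.IsSymm ∧ DataDissipative N l u y P a b) ↔
      ∀ f : S.op.domain, a * ‖S.op f‖ ^ 2 + b * ‖(f : ELL2 m)‖ ^ 2 ≤ 0 := by
  constructor
  · rintro ⟨P, -, hP⟩
    exact hP.forall_op (fun _ => hS.eq_zero_of_vecMul) hdata hu
  · intro h
    obtain ⟨T₀, hT₀⟩ := hS.exists_reachAt_eq_top
    obtain ⟨Q, hQs, hQ⟩ := exists_isStorage hT₀ fun v T hv => S.totalSupply_le_of_forall_op h hv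
    obtain ⟨M, hM⟩ := exists_stateMap_eq_extAt (S := S) fun _ => hS.eq_zero_of_lag_le hl
    refine ⟨Mᵀ * Q * M, ?_, hQ.dataDissipative hdata hM⟩
    have hQ' : Qᵀ = Q := hQs
    simp [Matrix.IsSymm, Matrix.transpose_mul, hQ', Matrix.mul_assoc]

/-- `hsupp` provides the trajectories that force `Q ⪰ 0`. It may assume the supply condition
because, for the minimum gain, invertibility of `D` is drawn from that condition. -/
theorem MarkovMinimal.exists_posSemidef_dataDissipative_iff (hS : S.MarkovMinimal)
    (hl : S.lag ≤ l) (hdata : S.IsTrajectory N u y) (hu : PersistentlyExciting N u (n + l + 1))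
    {a b c : ℝ} (hc : 0 < c)
    (hsupp : (∀ v T, S.totalSupply a b T 0 v ≤ 0) → ∀ x, ∃ v, ∀ k,
      c * (v k ⬝ᵥ v k + S.outMap k (x, v) ⬝ᵥ S.outMap k (x, v))
        ≤ supply a b (v k) (S.outMap k (x, v))) :
    (∃ P : Matrix (ExtIdx m l) (ExtIdx m l) ℝ, P.PosSemidef ∧ DataDissipative N l u y P a b) ↔
      ∀ v T, S.totalSupply a b T 0 v ≤ 0 := by
  constructor
  · rintro ⟨P, hP0, hP⟩ v T
    have h1 := hP.add_totalSupply_le (fun _ => hS.eq_zero_of_vecMul) hdata hu v T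
    have h2 := (Matrix.posSemidef_iff_isSymm.mp hP0).2
      (S.extAt l (0, seqAppend l 0 v) (T + l))
    linarith
  · intro h
    obtain ⟨T₀, hT₀⟩ := hS.exists_reachAt_eq_top
    obtain ⟨Q, hQs, hQ⟩ := exists_isStorage hT₀ fun v T _ => h v T
    have hobs : ∀ x : Fin n → ℝ, (∀ s < l, (S.C * S.A ^ s) *ᵥ x = 0) → x = 0 :=
      fun _ => hS.eq_zero_of_lag_le hl
    obtain ⟨M, hM⟩ := exists_stateMap_eq_extAt hobs
    refine ⟨Mᵀ * Q * M, Matrix.posSemidef_iff_isSymm.mpr ⟨?_, fun ξ => ?_⟩,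
      hQ.dataDissipative hdata hM⟩
    · have hQ' : Qᵀ = Q := hQs
      simp [Matrix.IsSymm, Matrix.transpose_mul, hQ', Matrix.mul_assoc]
    · rw [Matrix.dotProduct_transpose_mul_mul]
      obtain ⟨v, hv⟩ := hsupp h (M *ᵥ ξ)
      exact hQ.nonneg_of_supply hT₀ hobs h hc hv

/-- If no input of length one from the zero state has positive supply `ζ² |u|² - |y|²` with
`ζ > 0`, then the feedthrough matrix is invertible, and from every state some input keeps the
output at zero. -/
theorem exists_outMap_eq_zero {ζ : ℝ} (hζ : 0 < ζ)
    (h : ∀ v T, S.totalSupply (-1) (ζ ^ 2) T 0 v ≤ 0) (x : Fin n → ℝ) :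
    ∃ v, ∀ k, S.outMap k (x, v) = 0 := by
  have hD : IsUnit S.D := by
    rw [← Matrix.mulVec_injective_iff_isUnit]
    refine (injective_iff_map_eq_zero S.D.mulVecLin).mpr fun v hv => ?_
    have hv' : S.D *ᵥ v = 0 := hv
    have h1 := h (fun _ => v) 1
    simp only [totalSupply, Finset.range_one, Finset.sum_singleton, outMap_apply, stateMap_zero,
      Matrix.mulVec_zero, hv', zero_add, supply, dotProduct_zero, mul_zero] at h1
    have h2 : v ⬝ᵥ v ≤ 0 := nonpos_of_mul_nonpos_right h1 (by positivity)
    exact dotProduct_self_eq_zero.mp (le_antisymm h2 (dotProduct_self_nonneg_real v))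
  have hDD : S.D * S.D⁻¹ = 1 := Matrix.mul_nonsing_inv _ ((Matrix.isUnit_iff_isUnit_det _).mp hD)
  -- The closed loop under the feedback `u = -D⁻¹ C x`, which cancels the output.
  let w : ℕ → Fin n → ℝ := fun k => (S.A - S.B * S.D⁻¹ * S.C) ^ k *ᵥ x
  let v : ℕ → Fin m → ℝ := fun k => -(S.D⁻¹ *ᵥ (S.C *ᵥ w k))
  have hw : ∀ k, S.stateMap k (x, v) = w k := by
    intro k
    induction k with
    | zero => simp [w]
    | succ k ih =>
      rw [stateMap_succ, ih]
      simp only [w, v]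
      rw [pow_succ', ← Matrix.mulVec_mulVec, Matrix.sub_mulVec,
        Matrix.mulVec_neg, ← sub_eq_add_neg, ← Matrix.mulVec_mulVec, ← Matrix.mulVec_mulVec]
  refine ⟨v, fun k => ?_⟩
  rw [outMap_apply, hw]
  simp only [v, Matrix.mulVec_neg, Matrix.mulVec_mulVec, ← Matrix.mul_assoc, hDD, Matrix.one_mul]
  exact add_neg_cancel _

end StateSpace

theorem theorem2 {n m : ℕ} (S : StateSpace n m) (hS : S.IsMinimal)
    (l N : ℕ) (hl : S.lag ≤ l) (u y : ℕ → Fin m → ℝ)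
    (hdata : S.IsTrajectory N u y) (hu : PersistentlyExciting N u (n + l + 1)) :
    Tendsto (fun τ : ℕ => maxGain (S.truncOp τ)) atTop
      (𝓝 (⨅ (γ : ℝ≥0) (_ : ∃ P : Matrix (ExtIdx m l) (ExtIdx m l) ℝ,
        P.PosSemidef ∧ MaxGainLMI N l u y P γ), (γ : ℝ≥0∞))) ∧
    Tendsto (fun τ : ℕ => minGain (S.truncOp τ)) atTop
      (𝓝 (⨆ (ζ : ℝ≥0) (_ : ∃ P : Matrix (ExtIdx m l) (ExtIdx m l) ℝ,
        P.PosSemidef ∧ MinGainLMI N l u y P ζ), (ζ : ℝ≥0∞))) ∧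
    maxGain S.op =
      (⨅ (γ : ℝ≥0) (_ : ∃ P : Matrix (ExtIdx m l) (ExtIdx m l) ℝ,
        P.IsSymm ∧ MaxGainLMI N l u y P γ), (γ : ℝ≥0∞)) ∧
    minGain S.op =
      (⨆ (ζ : ℝ≥0) (_ : ∃ P : Matrix (ExtIdx m l) (ExtIdx m l) ℝ,
        P.IsSymm ∧ MinGainLMI N l u y P ζ), (ζ : ℝ≥0∞)) := by
  have hmin := hS.markovMinimal
  refine ⟨?_, ?_, ?_, ?_⟩
  · rw [ENNReal.iInf_nnreal_eq (x := ⨆ τ, maxGain (S.truncOp τ))]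
    · exact tendsto_atTop_iSup S.monotone_maxGain_truncOp
    · intro γ
      -- With zero input the supply is `|y|²`, so `c = 1`.
      have h := hmin.exists_posSemidef_dataDissipative_iff hl hdata hu (a := 1)
        (b := -(γ : ℝ) ^ 2) one_pos fun _ x => ⟨0, fun k => by simp [supply]⟩
      rw [iSup_le_iff]
      simp only [StateSpace.maxGain_truncOp_le_iff]
      rw [forall_comm, ← h]
      exact exists_congr fun P => and_congr_right fun hP =>
        maxGainLMI_iff (Matrix.posSemidef_iff_isSymm.mp hP).1
  · rw [ENNReal.iSup_nnreal_eq (x := ⨅ τ, minGain (S.truncOp τ))]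
    · exact tendsto_atTop_iInf S.antitone_minGain_truncOp
    · intro ζ
      -- For `ζ = 0` the matrix `D` need not be invertible, but `P = 0` is feasible.
      rcases eq_or_lt_of_le (zero_le : 0 ≤ ζ) with rfl | hζ
      · refine iff_of_true ⟨0, Matrix.PosSemidef.zero, ?_⟩ (by simp)
        rw [minGainLMI_iff (by simp [Matrix.IsSymm])]
        intro g
        have := dotProduct_self_nonneg_real (dataSignal N l y *ᵥ g)
        simpa [supply] using this
      · have hζ' : (0 : ℝ) < ζ := hζ
        -- With zero output the supply is `ζ² |u|²`, so `c = ζ²`.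
        have h := hmin.exists_posSemidef_dataDissipative_iff hl hdata hu (a := -1)
          (b := (ζ : ℝ) ^ 2) (c := (ζ : ℝ) ^ 2) (by positivity) fun h x => by
            obtain ⟨v, hv⟩ := StateSpace.exists_outMap_eq_zero hζ' h x
            exact ⟨v, fun k => by simp [hv, supply]⟩
        rw [le_iInf_iff]
        simp only [StateSpace.le_minGain_truncOp_iff]
        rw [forall_comm, ← h]
        exact exists_congr fun P => and_congr_right fun hP =>
          minGainLMI_iff (Matrix.posSemidef_iff_isSymm.mp hP).1
  · refine (ENNReal.iInf_nnreal_eq fun γ => ?_).symm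
    rw [StateSpace.maxGain_op_le_iff, ← hmin.exists_isSymm_dataDissipative_iff hl hdata hu]
    exact exists_congr fun P => and_congr_right fun hP => maxGainLMI_iff hP
  · refine (ENNReal.iSup_nnreal_eq fun ζ => ?_).symm
    rw [StateSpace.le_minGain_op_iff, ← hmin.exists_isSymm_dataDissipative_iff hl hdata hu]
    exact exists_congr fun P => and_congr_right fun hP => minGainLMI_iff hP
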